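/- **Conventions.** Everything is PL. $h^g=g^{-1}hg$, $[g,h]=g^{-1}h^{-1}gh$, and multiple commutators are left-normed. An $m$-component link is a PL embedding $L\colon mS^1=S^1_1\sqcup\dots\sqcup S^1_m\hookrightarrow S^3$; $\pi=\pi(L)=\pi_1(S^3\setminus L(mS^1))$, $\pi''$ is its second derived subgroup, and $M\subset\pi$ is the set of all meridians of all components. For a group $G$ and $a\in G$ put $\langle a\rangle_0^G=G$, and let $\langle a\rangle_{j+1}^G$ be the normal closure of $a$ in $\langle a\rangle_j^G$. For $k\ge 0$ let $$\mu_k=\big\langle [a,a^g]\ :\ a\in M,\ g\in\langle a\rangle_k^{\pi}\big\rangle,\qquad \delta_k=\big\langle [g,\underbrace{a,\dots,a}_{k+2}]\ :\ a\in M,\ g\in\pi\big\rangle .$$ **Crossing changes.** A PL map $f\colon mS^1\to S^3$ with a single double point $f(p)=f(q)$ is a *$k$-quasi-embedding* if $p,q$ lie in one component $S^1_i$ and, with $P_0=\{f(p)\}$, there are compact polyhedra $P_1\subset\dots\subset P_k\subset S^3\setminus\bigcup_{j\ne i}f(S^1_j)$ and arcs $J_0\subset\dots\subset J_{k-1}\subset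 S^1_i$ such that for $0\le j<k$ one has $f^{-1}(P_j)\subset J_j$, $f(J_j)\subset P_{j+1}$, and the inclusion $P_j\cup f(J_j)\subset P_{j+1}$ is null-homotopic. A self-crossing change $L_0\leftrightarrow L_1$ with intermediate singular link $L_s$ is *allowed in a $k$-quasi-isotopy* if $L_s$ is a $k$-quasi-embedding. An *elementary $k$-move* on $L$ is the interior connected sum of $L$ with the $k$-th Milnor curve $C$ in a solid torus $T\subset S^3\setminus L(mS^1)$ (the second component of the $(k+1)$-st Milnor link in the exterior $T$ of its unknotted first component), along a band which joins $C$ to $L$, meets $\partial T$ in one arc, and inside $T$ is the standard band from $C$ to $\partial T$. Here $C$ is the Whitehead curve if $k=0$; the $(k+1)$-st Milnor curve is the standard band sum of one component of the Bing double of the core of $T$ with the $k$-th Milnor curve in a tubular neighborhood of the other component. Opening the clasp of the innermost Whitehead curve makes $C$ trivial in $T$, so an elementary $k$-move is, up to ambient isotopy, a self-crossing change at that clasp. *Fine $k$-quasi-isotopy* is the equivalence relation generated by ambient isotopy and elementary $k$-moves. **Functorial invariance.** A quotient of the (metabelianized) fundamental group assigns to each $m$-component link $L$ a quotient $\pi(L)\to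 Q(L)$ (through $\pi(L)/\pi(L)''$), independently of the base point. It is *functorially invariant* under $k$-quasi-isotopy (respectively, fine $k$-quasi-isotopy) if it is invariant under ambient isotopy and, for each self-crossing change $L_0\leftrightarrow L_1$ allowed in a $k$-quasi-isotopy (respectively, given by the clasp of an elementary $k$-move), with singular link $L_s$, there is an isomorphism $Q(L_0)\cong Q(L_1)$ that commutes with the two homomorphisms $$\pi_1\big(S^3\setminus \text{regular neighborhood of } L_s(mS^1)\big)\to\pi(L_j)\to Q(L_j),\qquad j=0,1 .$$ **Theorem 3.7.** Let $m,k\ge 0$. 1. Any quotient of the metabelianized fundamental group of $m$-component links that is functorially invariant under $k$-quasi-isotopy is functorially invariant under fine $k$-quasi-isotopy. 2. For each $m$-component link $L$, the subgroups $\mu_k$ and $\delta_k$ of $\pi(L)$ have the same image in $\pi(L)/\pi(L)''$. -/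

import Mathlib

noncomputable section

/-! ### Group-theoretic part -/

namespace EngelSub

variable {G : Type*} [Group G]

/-- The conjugate `h ^ g = g⁻¹ h g`. -/
def cnj (h g : G) : G := g⁻¹ * h * g

/-- The commutator `[g, h] = g⁻¹ h⁻¹ g h`. -/
def comm (g h : G) : G := g⁻¹ * h⁻¹ * g * h

/-- The iterated normal closure `⟨a⟩_k^G`: `⟨a⟩_0^G = G`, and `⟨a⟩_{k+1}^G` is the normal closure
of `a` in the subgroup `⟨a⟩_k^G`. -/
def iterClosure (a : G) : ℕ → Subgroup G
  | 0 => ⊤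
  | k + 1 => Subgroup.closure {x | ∃ h ∈ iterClosure a k, x = cnj a h}

/-- `μ_k`, for a set `M` of "meridians": generated by the `[a, a ^ g]`, `a ∈ M`,
`g ∈ ⟨a⟩_k^G`. -/
def mu (M : Set G) (k : ℕ) : Subgroup G :=
  Subgroup.closure {x | ∃ a ∈ M, ∃ g ∈ iterClosure a k, x = comm a (cnj a g)}

/-- The left-normed commutator `[g, a, …, a]` with `n` entries `a`. -/
def engel (g a : G) : ℕ → G
  | 0 => g
  | n + 1 => comm (engel g a n) a

/-- `δ_k`: generated by the `[g, a, …, a]` (`k + 2` entries `a`), `a ∈ M`, `g ∈ G`. -/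
def delta (M : Set G) (k : ℕ) : Subgroup G :=
  Subgroup.closure {x | ∃ a ∈ M, ∃ g : G, x = engel g a (k + 2)}

end EngelSub

namespace PLTop

/-! ### PL topology -/

/-- The PL 3-sphere: the boundary of the cube `[-1,1]⁴` (unit sphere of the sup norm). -/
abbrev S3 : Type := Metric.sphere (0 : Fin 4 → ℝ) 1

/-- The PL circle: the boundary of the square `[-1,1]²`. -/
abbrev S1 : Type := Metric.sphere (0 : Fin 2 → ℝ) 1

/-- A compact polyhedron: a finite union of convex hulls of finite sets. -/
def IsPolyhedron {E : Type*} [AddCommGroup E] [Module ℝ E] (P : Set E) : Prop :=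
  ∃ F : Finset (Finset E), P = ⋃ s ∈ F, convexHull ℝ (s : Set E)

/-- `f` is PL on the compact polyhedron `P`: it is continuous and its graph is a polyhedron. -/
def IsPLOn {E : Type*} [AddCommGroup E] [Module ℝ E] [TopologicalSpace E]
    (f : E → S3) (P : Set E) : Prop :=
  ContinuousOn f P ∧ IsPolyhedron ((fun x => (x, (f x : Fin 4 → ℝ))) '' P)

/-- `f` is PL on `P` and embeds `P`. -/
def IsPLEmbOn {E : Type*} [AddCommGroup E] [Module ℝ E] [TopologicalSpace E]
    (f : E → S3) (P : Set E) : Prop :=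
  IsPLOn f P ∧ Set.InjOn f P

/-- A PL closed curve in `S³`. -/
def IsPLLoop (f : S1 → S3) : Prop :=
  Continuous f ∧
    IsPolyhedron (Set.range fun θ : S1 => ((θ : Fin 2 → ℝ), (f θ : Fin 4 → ℝ)))

/-- `h` is the final homeomorphism of a PL ambient isotopy of `S³`. -/
def IsPLIsotopicToId (h : S3 ≃ₜ S3) : Prop :=
  ∃ H : S3 × unitInterval → S3, Continuous H ∧
    IsPolyhedron (Set.range fun z : S3 × unitInterval =>
      (((z.1 : Fin 4 → ℝ), (z.2 : ℝ)), (H z : Fin 4 → ℝ))) ∧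
    (∀ t, Function.Bijective fun x => H (x, t)) ∧
    (∀ x, H (x, 0) = x) ∧ ∀ x, H (x, 1) = h x

/-- The cube `[-1,1]³`. -/
def cube : Set (Fin 3 → ℝ) := Set.Icc (-1) 1

/-! ### Links, their groups and meridians -/

/-- An `m`-component PL link `mS¹ ↪ S³`. -/
structure PLLink (m : ℕ) where
  toFun : Fin m → S1 → S3
  pl : ∀ c, IsPLLoop (toFun c)
  inj : Function.Injective fun z : Fin m × S1 => toFun z.1 z.2

/-- The image of a map `mS¹ → S³`. -/
def image {m : ℕ} (f : Fin m → S1 → S3) : Set S3 := {x | ∃ c θ, f c θ = x}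

/-- The complement of a link. -/
def PLLink.compl {m : ℕ} (L : PLLink m) : Set S3 := (image L.toFun)ᶜ

/-- The fundamental group `π(L)`, based at `x`. -/
abbrev PLLink.grp {m : ℕ} (L : PLLink m) (x : L.compl) : Type := FundamentalGroup L.compl x

/-- A PL tube around an arc of the link `L`: a PL embedding of the cube that meets `L` exactly
in the image of the third coordinate axis. -/
structure Tube {m : ℕ} (L : PLLink m) where
  e : (Fin 3 → ℝ) → S3
  pl : IsPLEmbOn e cube
  axis : ∀ u ∈ cube, e u ∈ image L.toFun ↔ u 0 = 0 ∧ u 1 = 0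

/-- The cube without the third coordinate axis; its fundamental group is infinite cyclic. -/
def puncturedCube : Set (Fin 3 → ℝ) := {u | u ∈ cube ∧ ¬ (u 0 = 0 ∧ u 1 = 0)}

/-- The embedding of the punctured cube in the link complement given by a tube. -/
def Tube.emb {m : ℕ} {L : PLLink m} (τ : Tube L) : C(puncturedCube, L.compl) where
  toFun u := ⟨τ.e u, fun h => u.2.2 ((τ.axis u u.2.1).1 h)⟩
  continuous_toFun := by
    refine Continuous.subtype_mk ?_ _
    exact (τ.pl.1.1.mono fun u hu => hu.1).domRestrict

/-- The set `M` of all meridians of `L` (of all components, with both orientations): a generator of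
the fundamental group of a punctured tube around an arc of `L`, connected to the base point by an
arbitrary path. -/
def PLLink.meridians {m : ℕ} (L : PLLink m) (x : L.compl) : Set (L.grp x) :=
  {g | ∃ (τ : Tube L) (y : puncturedCube) (γ : Path (τ.emb y) x)
    (u : FundamentalGroup puncturedCube y), (∀ v, v ∈ Subgroup.zpowers u) ∧
      g = FundamentalGroup.fundamentalGroupMulEquivOfPath γ (FundamentalGroup.map τ.emb y u)}

/-! ### Quasi-embeddings and crossing changes -/

/-- A (closed) arc in the circle. -/
def IsArc (J : Set S1) : Prop :=
  ∃ γ : unitInterval → S1, Continuous γ ∧ Function.Injective γ ∧ J = Set.range γ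

/-- `f : mS¹ → S³` is PL, and its only double point is `f i p = f i q`. -/
def HasSingleDoublePoint {m : ℕ} (f : Fin m → S1 → S3) (i : Fin m) (p q : S1) : Prop :=
  (∀ c, IsPLLoop (f c)) ∧ p ≠ q ∧ f i p = f i q ∧
    ∀ c θ c' θ', f c θ = f c' θ' → (c = c' ∧ θ = θ') ∨
      (c = i ∧ c' = i ∧ ((θ = p ∧ θ' = q) ∨ (θ = q ∧ θ' = p)))

/-- `f : mS¹ → S³` is a `k`-quasi-embedding with a single double point. -/
def IsSingularQuasiEmbedding {m : ℕ} (k : ℕ) (f : Fin m → S1 → S3) : Prop :=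
  ∃ (i : Fin m) (p q : S1), HasSingleDoublePoint f i p q ∧
    ∃ (P : ℕ → Set S3) (J : ℕ → Set S1), P 0 = {f i p} ∧
      (∀ j < k, IsPolyhedron (Subtype.val '' P (j + 1)) ∧
        (∀ c, c ≠ i → ∀ θ, f c θ ∉ P (j + 1)) ∧
        IsArc (J j) ∧ (j + 1 < k → J j ⊆ J (j + 1)) ∧
        f i ⁻¹' P j ⊆ J j ∧
        ∃ h : P j ∪ f i '' J j ⊆ P (j + 1), (ContinuousMap.inclusion h).Nullhomotopic)

/-- A self-crossing change `pos ↔ neg` of the component `i`, through the singular link `sing`.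
In the ball `e(cube)` the three maps are two strands parametrized by the subarcs `a`, `b` of the
circle: `b` runs along the second coordinate axis, and `a` runs above, through, respectively below
it along the first axis. Outside the ball the three maps coincide. -/
structure CrossingChange (m : ℕ) where
  pos : PLLink m
  neg : PLLink m
  sing : Fin m → S1 → S3
  sing_pl : ∀ c, IsPLLoop (sing c)
  i : Fin m
  e : (Fin 3 → ℝ) → S3
  e_pl : IsPLEmbOn e cube
  a : Set.Icc (-1 : ℝ) 1 → S1
  b : Set.Icc (-1 : ℝ) 1 → S1
  a_cont : Continuous a
  b_cont : Continuous b
  sing_a : ∀ t, sing i (a t) = e ![t, 0, 0]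
  pos_a : ∀ t, pos.toFun i (a t) = e ![t, 0, (1 - |(t : ℝ)|) / 2]
  neg_a : ∀ t, neg.toFun i (a t) = e ![t, 0, -((1 - |(t : ℝ)|) / 2)]
  sing_b : ∀ t, sing i (b t) = e ![0, t, 0]
  pos_b : ∀ t, pos.toFun i (b t) = e ![0, t, 0]
  neg_b : ∀ t, neg.toFun i (b t) = e ![0, t, 0]
  outside : ∀ c θ, ¬ (c = i ∧ θ ∈ Set.range a ∪ Set.range b) →
    sing c θ ∉ e '' cube ∧ pos.toFun c θ = sing c θ ∧ neg.toFun c θ = sing c θ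

namespace CrossingChange

variable {m : ℕ} (X : CrossingChange m)

/-- The exterior of the singular link: the complement of the union of its image with the ball
`e(cube)` around the double point. It is homotopy equivalent to the exterior of a regular
neighborhood of the image of `sing` that contains both `pos` and `neg`. -/
def ext : Set S3 := (image X.sing ∪ X.e '' cube)ᶜ

theorem strand_mem_cube {s t r : ℝ} (hs : |s| ≤ 1) (ht : |t| ≤ 1) (hr : |r| ≤ 1) :
    ![s, t, r] ∈ cube := by
  rw [abs_le] at hs ht hr
  constructor <;> intro j <;> fin_cases j <;> simp <;> linarith

theorem ext_sub_pos : X.ext ⊆ X.pos.compl := by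
  rintro x hx ⟨c, θ, rfl⟩
  by_cases h : c = X.i ∧ θ ∈ Set.range X.a ∪ Set.range X.b
  · obtain ⟨rfl, ⟨t, rfl⟩ | ⟨t, rfl⟩⟩ := h
    · have ht : |(t : ℝ)| ≤ 1 := abs_le.2 t.2
      have h0 := abs_nonneg (t : ℝ)
      refine hx (Or.inr ⟨_, ?_, (X.pos_a t).symm⟩)
      exact strand_mem_cube ht (by simp) (abs_le.2 ⟨by linarith, by linarith⟩)
    · exact hx (Or.inr ⟨_, strand_mem_cube (by simp) (abs_le.2 t.2) (by simp),
        (X.pos_b t).symm⟩)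
  · exact hx (Or.inl ⟨c, θ, (X.outside c θ h).2.1.symm⟩)

theorem ext_sub_neg : X.ext ⊆ X.neg.compl := by
  rintro x hx ⟨c, θ, rfl⟩
  by_cases h : c = X.i ∧ θ ∈ Set.range X.a ∪ Set.range X.b
  · obtain ⟨rfl, ⟨t, rfl⟩ | ⟨t, rfl⟩⟩ := h
    · have ht : |(t : ℝ)| ≤ 1 := abs_le.2 t.2
      have h0 := abs_nonneg (t : ℝ)
      refine hx (Or.inr ⟨_, ?_, (X.neg_a t).symm⟩)
      exact strand_mem_cube ht (by simp) (abs_le.2 ⟨by linarith, by linarith⟩)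
    · exact hx (Or.inr ⟨_, strand_mem_cube (by simp) (abs_le.2 t.2) (by simp),
        (X.neg_b t).symm⟩)
  · exact hx (Or.inl ⟨c, θ, (X.outside c θ h).2.2.symm⟩)

/-- The crossing change is allowed in a `k`-quasi-isotopy. -/
def IsAllowed (k : ℕ) : Prop := IsSingularQuasiEmbedding k X.sing

end CrossingChange

/-! ### Milnor curves and elementary moves -/

/-- The standard solid torus in `ℝ³`: a square annulus times an interval. -/
def solidTorus : Set (Fin 3 → ℝ) :=
  {v | |v 0| ≤ 3 ∧ |v 1| ≤ 3 ∧ |v 2| ≤ 1 ∧ (1 ≤ |v 0| ∨ 1 ≤ |v 1|)}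

/-- The polygonal path with the given vertices; the `n`-th edge is traversed for
`n ≤ t ≤ n + 1`. -/
def polyPath : List (Fin 3 → ℝ) → ℝ → Fin 3 → ℝ
  | [], _ => 0
  | [v], _ => v
  | v :: w :: l, t => if t ≤ 1 then AffineMap.lineMap v w t else polyPath (w :: l) (t - 1)

/-- The affine embedding of the standard solid torus in itself onto a neighborhood of one of the two
components of the Bing double of its core. -/
def bing (v : Fin 3 → ℝ) : Fin 3 → ℝ := ![2 + v 2 / 6, v 0 / 6, v 1 / 6]

/-- The first end on the boundary of the solid torus of the half-band. -/
def bandA : Fin 3 → ℝ := ![-3, 0, 1 / 2]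

/-- The second end on the boundary of the solid torus of the half-band. -/
def bandB : Fin 3 → ℝ := ![-3, 0, -1 / 2]

/-- The vertices of the singular `k`-th Milnor curve in the standard solid torus, opened along the
edge from the last vertex `(-2, -1/2, 0)` to the first vertex `(-2, 1/2, 0)`.
For `k = 0` this is the Whitehead curve with its clasp at the moment of the crossing change, at the
point `(9/4, 1/4, 0)`. The `(k+1)`-st curve is the band sum of the second component of the
Bing double of the core with the image of the `k`-th curve under `bing`. Moving the edge of
the innermost curve that runs along the first axis up, respectively down, off the
double point gives the Milnor curve, respectively an unknot in a ball in the solid torus. -/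
def milnorChain : ℕ → List (Fin 3 → ℝ)
  | 0 => [![-2, 1/2, 0], ![-2, 2, 0], ![9/4, 2, 0], ![9/4, 0, 0], ![9/4, -1/4, 1/4],
      ![5/4, -1/4, 1/4], ![5/4, 0, 0], ![5/4, 5/4, 0], ![-5/4, 5/4, 0], ![-5/4, -5/4, 0],
      ![7/4, -5/4, 0], ![7/4, 1/4, 0], ![11/4, 1/4, 0], ![11/4, -2, 0], ![-2, -2, 0],
      ![-2, -1/2, 0]]
  | k + 1 => [![-2, 1/2, 0], ![-2, 2, 0], ![5/2, 2, 0], ![5/2, 1/12, 0], ![3/2, 1/12, 0],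
      ![3/2, 3/2, 0], ![-3/2, 3/2, 0], ![-3/2, -3/2, 0], ![3/2, -3/2, 0], ![3/2, -1/12, 0],
      ![5/2, -1/12, 0], ![5/2, -2, 0], ![25/12, -2, 0]] ++
      (bandA :: (milnorChain k ++ [bandB])).map bing ++
      [![23/12, -2, 0], ![-2, -2, 0], ![-2, -1/2, 0]]

/-- The vertices of the proper polygonal arc in the solid torus that is formed by the opened singular
`k`-th Milnor curve together with the two long edges of the standard half-band,
which has the corners `(-2, 1/2, 0)`, `(-2, -1/2, 0)`, `bandB`, `bandA`. -/
def milnorArc (k : ℕ) : List (Fin 3 → ℝ) := bandA :: (milnorChain k ++ [bandB])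

/-- The number of edges of `milnorArc k`. -/
def milnorEdges (k : ℕ) : ℝ := ((milnorArc k).length : ℝ) - 1

/-- A cube around the double point of the singular Whitehead curve; its first two axes run along the two
strands of the curve. -/
def claspChart (u : Fin 3 → ℝ) : Fin 3 → ℝ := ![9/4 + u 0 / 8, 1/4 + u 1 / 8, u 2 / 8]

/-- `X` is the crossing change of an elementary `k`-move on `L`. There is a PL solid torus
`T = τ(solidTorus)` in the complement of `L`, and a band `β([0,1]²)` outside `T` that joins the
end `τ([bandA, bandB])` of the standard half-band in `T` to an arc of `L`. The singular link `X.sing`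
is the interior connected sum, along the union of the two bands, of `L` and the singular
`k`-th Milnor curve in `T`; the crossing change is that of the clasp of the Milnor curve. So `X.pos`
is the result of the elementary `k`-move on `L`, and `X.neg` is ambient isotopic to `L`. -/
def IsElementaryMove {m : ℕ} (k : ℕ) (L : PLLink m) (X : CrossingChange m) : Prop :=
  ∃ (τ : (Fin 3 → ℝ) → S3) (β : ℝ × ℝ → S3) (κ : ℝ → S1),
    IsPLEmbOn τ solidTorus ∧ Disjoint (τ '' solidTorus) (image L.toFun) ∧
    IsPLEmbOn β (Set.Icc 0 1 ×ˢ Set.Icc 0 1) ∧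
    (∀ s ∈ Set.Icc (0 : ℝ) 1, β (s, 0) = τ (AffineMap.lineMap bandA bandB s)) ∧
    (∀ s ∈ Set.Icc (0 : ℝ) 1, ∀ t ∈ Set.Icc (0 : ℝ) 1,
      (β (s, t) ∈ τ '' solidTorus ↔ t = 0) ∧ (β (s, t) ∈ image L.toFun ↔ t = 1)) ∧
    -- `κ` parametrizes the arc of the circle that is mapped by `L` onto the end of the band
    ContinuousOn κ (Set.Icc (-1) (milnorEdges k + 1)) ∧
    Set.InjOn κ (Set.Icc (-1) (milnorEdges k + 1)) ∧
    L.toFun X.i '' (κ '' Set.Icc (-1) (milnorEdges k + 1)) =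
      (fun s => β (s, 1)) '' Set.Icc (0 : ℝ) 1 ∧
    (∀ c θ, ¬ (c = X.i ∧ θ ∈ κ '' Set.Icc (-1) (milnorEdges k + 1)) →
      X.sing c θ = L.toFun c θ) ∧
    (∀ t ∈ Set.Icc (0 : ℝ) 1, X.sing X.i (κ (-t)) = β (0, t)) ∧
    (∀ t ∈ Set.Icc 0 (milnorEdges k), X.sing X.i (κ t) = τ (polyPath (milnorArc k) t)) ∧
    (∀ t ∈ Set.Icc (0 : ℝ) 1, X.sing X.i (κ (milnorEdges k + t)) = β (1, t)) ∧
    ∀ u ∈ cube, X.e u = τ (bing^[k] (claspChart u))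

/-! ### Quotients of link groups and functorial invariance -/

/-- A quotient of the fundamental groups of `m`-component links: a normal subgroup `ker L x` of
`π₁(S³ ∖ L, x)` for each link `L` and base point `x`, compatible with changes of base point. -/
structure GroupQuotient (m : ℕ) where
  ker : ∀ (L : PLLink m) (x : L.compl), Subgroup (L.grp x)
  normal : ∀ L x, (ker L x).Normal
  basepoint : ∀ (L : PLLink m) (x y : L.compl) (γ : Path x y),
    (ker L x).map (FundamentalGroup.fundamentalGroupMulEquivOfPath γ).toMonoidHom = ker L y

attribute [instance] GroupQuotient.normal

/-- The homeomorphism of complements induced by a homeomorphism of `S³` that takes `L` to `L'`. -/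
def complMap {m : ℕ} {L L' : PLLink m} (h : S3 ≃ₜ S3)
    (hL : ∀ c θ, L'.toFun c θ = h (L.toFun c θ)) : C(L.compl, L'.compl) where
  toFun x := ⟨h x, by
    rintro ⟨c, θ, hx⟩
    rw [hL] at hx
    exact x.2 ⟨c, θ, h.injective hx⟩⟩
  continuous_toFun := (h.continuous.comp continuous_subtype_val).subtype_mk _

namespace GroupQuotient

variable {m : ℕ} (Q : GroupQuotient m)

/-- `Q` is a quotient of the metabelianized fundamental group `π/π''`. -/
def IsMetabelian : Prop := ∀ (L : PLLink m) (x : L.compl), derivedSeries (L.grp x) 2 ≤ Q.ker L x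

/-- `Q` is an invariant of ambient isotopy. -/
def IsotopyInvariant : Prop :=
  ∀ (L L' : PLLink m) (h : S3 ≃ₜ S3) (_ : IsPLIsotopicToId h)
    (hL : ∀ c θ, L'.toFun c θ = h (L.toFun c θ)) (x : L.compl),
    (Q.ker L x).map (FundamentalGroup.map (complMap h hL) x) = Q.ker L' (complMap h hL x)

/-- There is an isomorphism `Q(pos) ≅ Q(neg)` that makes the diagram with the
homomorphisms from the fundamental group of the exterior of the singular link commute. -/
def Respects (X : CrossingChange m) : Prop :=
  ∀ x : X.ext, ∃ φ :
    (X.pos.grp ⟨x, X.ext_sub_pos x.2⟩ ⧸ Q.ker X.pos ⟨x, X.ext_sub_pos x.2⟩) ≃*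
      (X.neg.grp ⟨x, X.ext_sub_neg x.2⟩ ⧸ Q.ker X.neg ⟨x, X.ext_sub_neg x.2⟩),
    ∀ g : FundamentalGroup X.ext x,
      φ (QuotientGroup.mk (FundamentalGroup.map (ContinuousMap.inclusion X.ext_sub_pos) x g)) =
        QuotientGroup.mk (FundamentalGroup.map (ContinuousMap.inclusion X.ext_sub_neg) x g)

/-- Functorial invariance under `k`-quasi-isotopy. -/
def FunctoriallyInvariant (k : ℕ) : Prop :=
  Q.IsotopyInvariant ∧ ∀ X : CrossingChange m, X.IsAllowed k → Q.Respects X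

/-- Functorial invariance under fine `k`-quasi-isotopy, the relation that is generated by ambient
isotopy and elementary `k`-moves. -/
def FinelyFunctoriallyInvariant (k : ℕ) : Prop :=
  Q.IsotopyInvariant ∧
    ∀ (L : PLLink m) (X : CrossingChange m), IsElementaryMove k L X → Q.Respects X

end GroupQuotient

end PLTop

end

/-! Write `T_n` for the image of the solid torus under `τ ∘ bing^[n]`. An elementary `k`-move takes
place in the nest `T_0 ⊃ T_1 ⊃ … ⊃ T_k`, where the Milnor curve is built by iterated Bing doubling.
For the first claim it suffices that the crossing change of the move is itself allowed in a
`k`-quasi-isotopy (`IsElementaryMove.isAllowed`); the quotient then respects it by hypothesis. The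
witnesses are `P_0`, the double point, which lies in `T_k`, and `P_j = T_{k-j}` for `j > 0`; `J_j`
is the stretch of the curve inside `T_{k-j}`. Two facts are needed. The singular component meets
`T_n` in a single arc, because outside the smaller copy the Milnor arc either stays beside the image
of `bing` or passes through its hole (`mem_Icc_of_polyPath_milnorArc_add_mem`). The inclusion of
`T_{n+1}` in `T_n` is null-homotopic, because `bing` maps the solid torus into a convex box inside
the solid torus (`nullhomotopic_inclusion_of_convex`). That each `T_n` is a polyhedron comes from
cutting the graph of `τ` by half-spaces and projecting. The second claim is pure group theory.
Surjections carry `mu` to `mu` and `delta` to `delta`, so it is enough to compare them when the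
commutator subgroup is abelian. There `[a, a^g] = [a, [a, g]] = [g, a, a]`. Since `[g, a, …, a]`
with `k` entries `a` lies in the `k`-th iterated closure of `a`, `delta` is contained in `mu`.
Conversely, `[g, a]` for `g` in that closure is a product of left-normed commutators with `k + 1`
entries `a` and their inverses (`comm_mem_engelClosure_of_mem_iterClosure`), which gives the other
inclusion. -/

namespace EngelSub

/-! ### Images under surjective homomorphisms -/

section Hom

variable {G H : Type*} [Group G] [Group H] (f : G →* H)

theorem map_comm (g h : G) : f (comm g h) = comm (f g) (f h) := by simp [comm]

theorem map_cnj (h g : G) : f (cnj h g) = cnj (f h) (f g) := by simp [cnj]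

theorem map_engel (g a : G) (n : ℕ) : f (engel g a n) = engel (f g) (f a) n := by
  induction n with
  | zero => rfl
  | succ n ih => simp only [engel, map_comm, ih]

theorem map_iterClosure (hf : Function.Surjective f) (a : G) (k : ℕ) :
    (iterClosure a k).map f = iterClosure (f a) k := by
  induction k with
  | zero => simpa [iterClosure, ← MonoidHom.range_eq_map] using MonoidHom.range_eq_top.2 hf
  | succ k ih =>
    simp only [iterClosure, MonoidHom.map_closure, ← ih]
    congr 1
    ext x
    constructor
    · rintro ⟨_, ⟨h, hh, rfl⟩, rfl⟩
      exact ⟨f h, ⟨h, hh, rfl⟩, map_cnj f a h⟩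
    · rintro ⟨_, ⟨h, hh, rfl⟩, rfl⟩
      exact ⟨_, ⟨h, hh, rfl⟩, map_cnj f a h⟩

theorem map_mu (hf : Function.Surjective f) (M : Set G) (k : ℕ) :
    (mu M k).map f = mu (f '' M) k := by
  rw [mu, mu, MonoidHom.map_closure]
  congr 1
  ext x
  constructor
  · rintro ⟨_, ⟨a, ha, g, hg, rfl⟩, rfl⟩
    refine ⟨f a, ⟨a, ha, rfl⟩, f g, ?_, by rw [map_comm, map_cnj]⟩
    rw [← map_iterClosure f hf]
    exact ⟨g, hg, rfl⟩
  · rintro ⟨_, ⟨a, ha, rfl⟩, g, hg, rfl⟩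
    rw [← map_iterClosure f hf] at hg
    obtain ⟨g, hg, rfl⟩ := hg
    exact ⟨_, ⟨a, ha, g, hg, rfl⟩, by rw [map_comm, map_cnj]⟩

theorem map_delta (hf : Function.Surjective f) (M : Set G) (k : ℕ) :
    (delta M k).map f = delta (f '' M) k := by
  rw [delta, delta, MonoidHom.map_closure]
  congr 1
  ext x
  constructor
  · rintro ⟨_, ⟨a, ha, g, rfl⟩, rfl⟩
    exact ⟨f a, ⟨a, ha, rfl⟩, f g, map_engel f g a _⟩
  · rintro ⟨_, ⟨a, ha, rfl⟩, g, rfl⟩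
    obtain ⟨g, rfl⟩ := hf g
    exact ⟨_, ⟨a, ha, g, rfl⟩, map_engel f g a _⟩

end Hom

/-! ### Commutator identities valid in every group -/

variable {G : Type*} [Group G]

theorem comm_mem_commutator (g h : G) : comm g h ∈ commutator G := by
  have := Subgroup.commutator_mem_commutator (Subgroup.mem_top g⁻¹) (Subgroup.mem_top h⁻¹)
  simpa [commutatorElement_def, comm, commutator_def] using this

theorem comm_inv (g h : G) : (comm g h)⁻¹ = comm h g := by simp [comm, mul_assoc]

theorem comm_mul_left (g h a : G) : comm (g * h) a = cnj (comm g a) h * comm h a := by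
  simp only [comm, cnj]; group

theorem comm_inv_left (g a : G) : comm g⁻¹ a = cnj (comm g a)⁻¹ g⁻¹ := by
  simp only [comm, cnj]; group

/-- Because `a^g = a [a, g]` and `a` commutes with itself. -/
theorem comm_cnj_self (a g : G) : comm a (cnj a g) = comm a (comm a g) := by
  simp only [comm, cnj]; group

theorem comm_cnj_left (a h : G) : comm (cnj a h) a = comm (comm a h) a := by
  simp only [comm, cnj]; group

/-- The factorization `[g, a] = (a^g)⁻¹ a` has both factors conjugate to `a` by elements of the
`k`-th closure. -/
theorem comm_mem_iterClosure {a g : G} {k : ℕ} (hg : g ∈ iterClosure a k) :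
    comm g a ∈ iterClosure a (k + 1) := by
  have one_mem : (1 : G) ∈ iterClosure a k := by cases k <;> exact one_mem _
  have h₁ : cnj a g ∈ iterClosure a (k + 1) := Subgroup.subset_closure ⟨g, hg, rfl⟩
  have h₂ : cnj a 1 ∈ iterClosure a (k + 1) := Subgroup.subset_closure ⟨1, one_mem, rfl⟩
  have : comm g a = (cnj a g)⁻¹ * cnj a 1 := by simp only [comm, cnj]; group
  rw [this]
  exact mul_mem (inv_mem h₁) h₂

theorem engel_mem_iterClosure (g a : G) (k : ℕ) : engel g a k ∈ iterClosure a k := by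
  induction k with
  | zero => trivial
  | succ k ih => exact comm_mem_iterClosure ih

/-- The subgroup generated by the left-normed commutators `[g, a, …, a]` with `n` entries `a`. -/
def engelClosure (a : G) (n : ℕ) : Subgroup G :=
  Subgroup.closure {x | ∃ g, x = engel g a n}

theorem engelClosure_le_commutator (a : G) (n : ℕ) :
    engelClosure a (n + 1) ≤ commutator G := by
  refine (Subgroup.closure_le _).2 ?_
  rintro _ ⟨g, rfl⟩
  exact comm_mem_commutator _ _

/-! ### Groups with abelian commutator subgroup -/

section Metabelian

theorem cnj_eq_self
    (hG : ∀ x ∈ commutator G, ∀ y ∈ commutator G, x * y = y * x)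
    {x y : G} (hx : x ∈ commutator G) (hy : y ∈ commutator G) : cnj x y = x := by
  rw [cnj, mul_assoc, hG x hx y hy, inv_mul_cancel_left]

theorem comm_mul_of_mem_commutator
    (hG : ∀ x ∈ commutator G, ∀ y ∈ commutator G, x * y = y * x)
    {x y : G} (hy : y ∈ commutator G) (a : G) :
    comm (x * y) a = comm x a * comm y a := by
  rw [comm_mul_left, cnj_eq_self hG (comm_mem_commutator _ _) hy]

theorem comm_inv_of_mem_commutator
    (hG : ∀ x ∈ commutator G, ∀ y ∈ commutator G, x * y = y * x)
    {x : G} (hx : x ∈ commutator G) (a : G) :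
    comm x⁻¹ a = (comm x a)⁻¹ := by
  rw [comm_inv_left, cnj_eq_self hG (inv_mem (comm_mem_commutator _ _)) (inv_mem hx)]

/-- Two inversions cancel: one from exchanging the outer entries, the other from `[a, g] = [g,
a]⁻¹`, since `x ↦ [x, a]` is a homomorphism on the commutator subgroup. -/
theorem comm_comm_swap
    (hG : ∀ x ∈ commutator G, ∀ y ∈ commutator G, x * y = y * x)
    (a g : G) : comm a (comm a g) = comm (comm g a) a := by
  rw [← comm_inv, ← comm_inv g a, comm_inv_of_mem_commutator hG (comm_mem_commutator _ _), inv_inv]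

theorem comm_mem_engelClosure
    (hG : ∀ x ∈ commutator G, ∀ y ∈ commutator G, x * y = y * x)
    {a x : G} {n : ℕ} (hx : x ∈ engelClosure a (n + 1)) :
    comm x a ∈ engelClosure a (n + 2) := by
  induction hx using Subgroup.closure_induction with
  | mem x hx =>
    obtain ⟨g, rfl⟩ := hx
    exact Subgroup.subset_closure ⟨g, rfl⟩
  | one => simp [comm]
  | mul x y _ hy ihx ihy =>
    rw [comm_mul_of_mem_commutator hG (engelClosure_le_commutator a n hy)]
    exact mul_mem ihx ihy
  | inv x hx ih =>
    rw [comm_inv_of_mem_commutator hG (engelClosure_le_commutator a n hx)]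
    exact inv_mem ih

/-- Conjugation by `y` replaces `a` by `a^y = a [a, y]`; the extra factor is a commutator, so it
commutes with `x^y` and with `[x^y, a]`, and disappears. -/
theorem cnj_comm_of_mem_commutator
    (hG : ∀ x ∈ commutator G, ∀ y ∈ commutator G, x * y = y * x)
    {x : G} (hx : x ∈ commutator G) (a y : G) :
    cnj (comm x a) y = comm (cnj x y) a := by
  have hxy : cnj x y ∈ commutator G := by
    simpa [cnj] using (inferInstance : (commutator G).Normal).conj_mem x hx y⁻¹
  have h₁ : cnj (comm x a) y = comm (cnj x y) (a * comm a y) := by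
    simp only [comm, cnj]; group
  have h₂ : comm (cnj x y) (a * comm a y) =
      comm (cnj x y) (comm a y) * cnj (comm (cnj x y) a) (comm a y) := by
    simp only [comm, cnj]; group
  have h₃ : comm (cnj x y) (comm a y) = 1 := by
    rw [comm, mul_assoc, hG _ hxy _ (comm_mem_commutator _ _)]; group
  rw [h₁, h₂, h₃, one_mul, cnj_eq_self hG (comm_mem_commutator _ _) (comm_mem_commutator _ _)]

/-- Normality of `engelClosure` is what makes the product rule `[xy, a] = [x, a]^y [y, a]` usable on
elements outside the commutator subgroup. -/
theorem cnj_mem_engelClosure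
    (hG : ∀ x ∈ commutator G, ∀ y ∈ commutator G, x * y = y * x)
    {a x : G} {n : ℕ} (hx : x ∈ engelClosure a (n + 1)) (y : G) :
    cnj x y ∈ engelClosure a (n + 1) := by
  induction n generalizing x with
  | zero =>
    induction hx using Subgroup.closure_induction with
    | mem x hx =>
      obtain ⟨g, rfl⟩ := hx
      -- The product rule solved for its conjugated factor; this base case holds in every group.
      have : cnj (engel g a 1) y = engel (g * y) a 1 * (engel y a 1)⁻¹ := by
        simp only [engel, comm_mul_left, mul_inv_cancel_right]
      rw [zero_add, this]
      exact mul_mem (Subgroup.subset_closure ⟨_, rfl⟩) (inv_mem (Subgroup.subset_closure ⟨_, rfl⟩))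
    | one => simp [cnj]
    | mul x z _ _ ihx ihz =>
      have : cnj (x * z) y = cnj x y * cnj z y := by simp only [cnj]; group
      exact this ▸ mul_mem ihx ihz
    | inv x _ ih =>
      have : cnj x⁻¹ y = (cnj x y)⁻¹ := by simp only [cnj]; group
      exact this ▸ inv_mem ih
  | succ n ihn =>
    induction hx using Subgroup.closure_induction with
    | mem x hx =>
      obtain ⟨g, rfl⟩ := hx
      have hmem : engel g a (n + 1) ∈ engelClosure a (n + 1) := Subgroup.subset_closure ⟨g, rfl⟩
      rw [engel, cnj_comm_of_mem_commutator hG (engelClosure_le_commutator a n hmem)]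
      exact comm_mem_engelClosure hG (ihn hmem)
    | one => simp [cnj]
    | mul x z _ _ ihx ihz =>
      have : cnj (x * z) y = cnj x y * cnj z y := by simp only [cnj]; group
      exact this ▸ mul_mem ihx ihz
    | inv x _ ih =>
      have : cnj x⁻¹ y = (cnj x y)⁻¹ := by simp only [cnj]; group
      exact this ▸ inv_mem ih

/-- On a generator `a^h` one has `[a^h, a] = [[a, h], a]`, and `[a, h]` is inverse to `[h, a]`, to
which the induction hypothesis applies. Products and inverses are handled by normality. -/
theorem comm_mem_engelClosure_of_mem_iterClosure
    (hG : ∀ x ∈ commutator G, ∀ y ∈ commutator G, x * y = y * x)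
    {a g : G} {k : ℕ} (hg : g ∈ iterClosure a k) :
    comm g a ∈ engelClosure a (k + 1) := by
  induction k generalizing g with
  | zero => exact Subgroup.subset_closure ⟨g, rfl⟩
  | succ k ih =>
    induction hg using Subgroup.closure_induction with
    | mem x hx =>
      obtain ⟨h, hh, rfl⟩ := hx
      rw [comm_cnj_left, ← comm_inv h a]
      exact comm_mem_engelClosure hG (inv_mem (ih hh))
    | one => simp [comm]
    | mul x y _ _ ihx ihy =>
      rw [comm_mul_left]
      exact mul_mem (cnj_mem_engelClosure hG ihx y) ihy
    | inv x _ ih =>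
      rw [comm_inv_left]
      exact cnj_mem_engelClosure hG (inv_mem ih) _

theorem mu_eq_delta
    (hG : ∀ x ∈ commutator G, ∀ y ∈ commutator G, x * y = y * x)
    (M : Set G) (k : ℕ) : mu M k = delta M k := by
  apply le_antisymm
  · refine (Subgroup.closure_le _).2 ?_
    rintro _ ⟨a, ha, g, hg, rfl⟩
    rw [comm_cnj_self, comm_comm_swap hG]
    have := comm_mem_engelClosure hG (comm_mem_engelClosure_of_mem_iterClosure hG hg)
    refine Subgroup.closure_mono ?_ this
    rintro _ ⟨g, rfl⟩
    exact ⟨a, ha, g, rfl⟩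
  · refine (Subgroup.closure_le _).2 ?_
    rintro _ ⟨a, ha, g, rfl⟩
    -- With `h = [g, a, …, a]` (`k` entries `a`), `[a, a^h] = [h, a, a]` supplies the last two
    -- entries.
    refine Subgroup.subset_closure ⟨a, ha, engel g a k, engel_mem_iterClosure g a k, ?_⟩
    rw [comm_cnj_self, comm_comm_swap hG, engel, engel]

end Metabelian

/-! ### Passage to the metabelianization -/

theorem commute_of_mem_commutator_metabelianization (x y : G ⧸ derivedSeries G 2)
    (hx : x ∈ commutator (G ⧸ derivedSeries G 2)) (hy : y ∈ commutator (G ⧸ derivedSeries G 2)) :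
    x * y = y * x := by
  have hmap : commutator (G ⧸ derivedSeries G 2) =
      (commutator G).map (QuotientGroup.mk' (derivedSeries G 2)) := by
    rw [commutator_def, commutator_def, Subgroup.map_commutator, ← MonoidHom.range_eq_map,
      MonoidHom.range_eq_top.2 (QuotientGroup.mk'_surjective _)]
  rw [hmap] at hx hy
  obtain ⟨x, hx, rfl⟩ := hx
  obtain ⟨y, hy, rfl⟩ := hy
  rw [← map_mul, ← map_mul]
  refine QuotientGroup.eq.2 ?_
  have := Subgroup.commutator_mem_commutator (inv_mem hy) (inv_mem hx)
  rw [← derivedSeries_one, ← derivedSeries_succ] at this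
  simpa [commutatorElement_def, mul_assoc] using this

theorem map_mu_eq_map_delta (M : Set G) (k : ℕ) :
    (mu M k).map (QuotientGroup.mk' (derivedSeries G 2)) =
      (delta M k).map (QuotientGroup.mk' (derivedSeries G 2)) := by
  have hs := QuotientGroup.mk'_surjective (derivedSeries G 2)
  rw [map_mu _ hs, map_delta _ hs]
  exact mu_eq_delta (fun x hx y hy => commute_of_mem_commutator_metabelianization x y hx hy) _ k

end EngelSub

namespace PLTop

/-! ### Polyhedra -/

section Polyhedra

variable {E F : Type*} [AddCommGroup E] [Module ℝ E] [AddCommGroup F] [Module ℝ F]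

theorem isPolyhedron_convexHull (s : Finset E) : IsPolyhedron (convexHull ℝ (s : Set E)) :=
  ⟨{s}, by simp⟩

theorem IsPolyhedron.union {P R : Set E} (hP : IsPolyhedron P) (hR : IsPolyhedron R) :
    IsPolyhedron (P ∪ R) := by
  classical
  obtain ⟨A, rfl⟩ := hP
  obtain ⟨B, rfl⟩ := hR
  exact ⟨A ∪ B, (Finset.set_biUnion_union A B _).symm⟩

theorem IsPolyhedron.biUnion {ι : Type*} (s : Finset ι) {P : ι → Set E}
    (hP : ∀ i ∈ s, IsPolyhedron (P i)) : IsPolyhedron (⋃ i ∈ s, P i) := by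
  classical
  induction s using Finset.induction_on with
  | empty => exact ⟨∅, by simp⟩
  | insert i s _ ih =>
    rw [Finset.set_biUnion_insert]
    exact (hP i (Finset.mem_insert_self i s)).union
      (ih fun j hj => hP j (Finset.mem_insert_of_mem hj))

theorem IsPolyhedron.image {P : Set E} (hP : IsPolyhedron P) (g : E →ₗ[ℝ] F) :
    IsPolyhedron (g '' P) := by
  classical
  obtain ⟨A, rfl⟩ := hP
  rw [Set.image_iUnion₂]
  refine IsPolyhedron.biUnion A fun s _ => ?_
  rw [LinearMap.image_convexHull, ← Finset.coe_image]
  exact isPolyhedron_convexHull _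

/-- A half-space cuts a polytope in the convex hull of the vertices that it contains and the
points where the boundary hyperplane meets the segments between vertices. -/
theorem isPolyhedron_convexHull_inter_halfspace (s : Finset E) (l : E →ᵃ[ℝ] ℝ) :
    IsPolyhedron (convexHull ℝ (s : Set E) ∩ {x | l x ≤ 0}) := by
  classical
  set p : E × E → E := fun z => AffineMap.lineMap z.1 z.2 (l z.1 / (l z.1 - l z.2)) with hp
  set s₀ := s.filter fun v => l v ≤ 0 with hs₀
  set s₁ := s.filter fun v => ¬ l v ≤ 0 with hs₁
  have hK : convexHull ℝ (s : Set E) ∩ {x | l x ≤ 0} =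
      convexHull ℝ ((s₀ ∪ (s₀ ×ˢ s₁).image p : Finset E) : Set E) := by
    apply Set.Subset.antisymm
    · rintro x ⟨hx, hlx⟩
      rw [Finset.mem_convexHull'] at hx
      obtain ⟨w, hw, hw1, rfl⟩ := hx
      have hl : l (∑ y ∈ s, w y • y) = ∑ y ∈ s, w y * l y := by
        have := s.map_affineCombination (fun y => y) w hw1 l
        rw [s.affineCombination_eq_linear_combination _ _ hw1,
          s.affineCombination_eq_linear_combination _ _ hw1] at this
        simpa using this
      rw [Set.mem_ofPred_eq, hl, ← Finset.sum_filter_add_sum_filter_not s (fun v => l v ≤ 0)] at hlx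
      rw [← Finset.sum_filter_add_sum_filter_not s (fun v => l v ≤ 0)] at hw1 ⊢
      rw [← hs₀, ← hs₁] at hlx hw1 ⊢
      have hw₀ : ∀ y ∈ s₀, 0 ≤ w y := fun y hy => hw y (Finset.mem_filter.1 hy).1
      have hw₁ : ∀ y ∈ s₁, 0 ≤ w y := fun y hy => hw y (Finset.mem_filter.1 hy).1
      have hl₀ : ∀ y ∈ s₀, l y ≤ 0 := fun y hy => (Finset.mem_filter.1 hy).2
      have hl₁ : ∀ y ∈ s₁, 0 < l y := fun y hy => not_le.1 (Finset.mem_filter.1 hy).2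
      set a := ∑ y ∈ s₀, w y * l y with ha
      set b := ∑ y ∈ s₁, w y * l y with hb
      have hb0 : 0 ≤ b := Finset.sum_nonneg fun y hy => mul_nonneg (hw₁ y hy) (hl₁ y hy).le
      rcases hb0.eq_or_lt with hb0 | hb0
      · have hz : ∀ y ∈ s₁, w y = 0 := by
          intro y hy
          have := (Finset.sum_eq_zero_iff_of_nonneg
            fun y hy => mul_nonneg (hw₁ y hy) (hl₁ y hy).le).1 hb0.symm y hy
          exact (mul_eq_zero.1 this).resolve_right (hl₁ y hy).ne'
        rw [Finset.sum_eq_zero hz, add_zero] at hw1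
        rw [Finset.sum_eq_zero (s := s₁) fun y hy => by rw [hz y hy, zero_smul], add_zero]
        refine (convex_convexHull ℝ _).sum_mem hw₀ hw1 fun y hy => subset_convexHull ℝ _ ?_
        exact Finset.mem_coe.2 (Finset.mem_union_left _ hy)
      · have ha0 : a < 0 := by linarith
        have ha' : a ≠ 0 := ha0.ne
        -- Balance the positive total `b` against the share `-b / a` of every vertex `y` of `s₀`.
        -- The pair `(y, z)` then contributes a multiple of the zero `p (y, z)` of `l` on the
        -- segment; the share `1 + b / a` left at `y` is nonnegative because `a + b ≤ 0`.
        have hx : ∑ y ∈ s₀, w y • y + ∑ y ∈ s₁, w y • y =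
            ∑ z ∈ s₀.disjSum (s₀ ×ˢ s₁),
              Sum.elim (fun y => w y * (1 + b / a))
                (fun z => w z.1 * w z.2 * (l z.2 - l z.1) / (-a)) z • Sum.elim id p z := by
          have hpt : ∀ y ∈ s₀, ∀ z ∈ s₁,
              (w y * w z * (l z - l y) / (-a)) • p (y, z) =
                (w z * l z * (w y / (-a))) • y + (w y * l y * (w z / a)) • z := by
            intro y hy z hz
            have hyz : l y - l z ≠ 0 := by linarith [hl₀ y hy, hl₁ z hz]
            simp only [hp]
            rw [AffineMap.lineMap_apply_module, smul_add, smul_smul, smul_smul]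
            congr 2
            · field_simp
              ring
            · field_simp
              ring
          rw [Finset.sum_disjSum, Finset.sum_product]
          simp only [Sum.elim_inl, Sum.elim_inr, id]
          rw [Finset.sum_congr rfl fun y hy => Finset.sum_congr rfl fun z hz => hpt y hy z hz]
          simp only [Finset.sum_add_distrib]
          rw [Finset.sum_comm (s := s₀) (t := s₁) (f := fun y z => (w y * l y * (w z / a)) • z)]
          simp only [← Finset.sum_smul, ← Finset.sum_mul]
          rw [← ha, ← hb, ← add_assoc, ← Finset.sum_add_distrib]
          congr 1
          · refine Finset.sum_congr rfl fun y _ => ?_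
            rw [← add_smul]
            congr 1
            field_simp
            ring
          · refine Finset.sum_congr rfl fun y _ => ?_
            congr 1
            field_simp
        have hab : 0 ≤ 1 + b / a := by
          rw [one_add_div ha0.ne]
          exact div_nonneg_of_nonpos hlx ha0.le
        rw [hx]
        refine (convex_convexHull ℝ _).sum_mem ?_ ?_ ?_
        · rintro (y | ⟨y, z⟩) h
          · exact mul_nonneg (hw₀ y (Finset.inl_mem_disjSum.1 h)) hab
          · obtain ⟨hy, hz⟩ := Finset.mem_product.1 (Finset.inr_mem_disjSum.1 h)
            exact div_nonneg (mul_nonneg (mul_nonneg (hw₀ y hy) (hw₁ z hz))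
              (by linarith [hl₀ y hy, hl₁ z hz])) (by linarith)
        · rw [Finset.sum_disjSum, Finset.sum_product]
          simp only [Sum.elim_inl, Sum.elim_inr]
          have hpt : ∀ y z, w y * w z * (l z - l y) / (-a) =
              w z * l z * (w y / (-a)) + w y * l y * (w z / a) := by
            intro y z
            field_simp
            ring
          simp only [hpt, Finset.sum_add_distrib]
          rw [Finset.sum_comm (s := s₀) (t := s₁) (f := fun y z => w y * l y * (w z / a))]
          simp only [← Finset.sum_mul, ← Finset.mul_sum, ← Finset.sum_div]
          rw [← ha, ← hb]
          refine Eq.trans ?_ hw1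
          field_simp
          ring
        · rintro (y | z) h
          · refine subset_convexHull ℝ _ (Finset.mem_coe.2 (Finset.mem_union_left _ ?_))
            exact Finset.inl_mem_disjSum.1 h
          · refine subset_convexHull ℝ _ (Finset.mem_coe.2 (Finset.mem_union_right _ ?_))
            exact Finset.mem_image_of_mem p (Finset.inr_mem_disjSum.1 h)
    · refine convexHull_min ?_ ((convex_convexHull ℝ _).inter ?_)
      · intro x hx
        rcases Finset.mem_union.1 (Finset.mem_coe.1 hx) with hx | hx
        · exact ⟨subset_convexHull ℝ _ (Finset.mem_filter.1 hx).1, (Finset.mem_filter.1 hx).2⟩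
        · obtain ⟨⟨y, z⟩, hyz, rfl⟩ := Finset.mem_image.1 hx
          obtain ⟨hy, hz⟩ := Finset.mem_product.1 hyz
          obtain ⟨hys, hly⟩ := Finset.mem_filter.1 hy
          obtain ⟨hzs, hlz⟩ := Finset.mem_filter.1 hz
          simp only at hys hly hzs hlz
          have hneg : l y - l z < 0 := by linarith
          have hne : l y - l z ≠ 0 := hneg.ne
          refine ⟨(convex_convexHull ℝ _).lineMap_mem (subset_convexHull ℝ _ hys)
            (subset_convexHull ℝ _ hzs) ⟨div_nonneg_of_nonpos hly hneg.le, ?_⟩, ?_⟩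
          · exact (div_le_one_of_neg hneg).2 (by linarith)
          · have : l (p (y, z)) = 0 := by
              rw [hp, AffineMap.apply_lineMap, AffineMap.lineMap_apply_module]
              simp only [smul_eq_mul]
              field_simp
              ring
            exact this.le
      · exact (convex_Iic (0 : ℝ)).affine_preimage l
  rw [hK]
  exact isPolyhedron_convexHull _

theorem IsPolyhedron.inter_halfspace {P : Set E} (hP : IsPolyhedron P) (l : E →ᵃ[ℝ] ℝ) :
    IsPolyhedron (P ∩ {x | l x ≤ 0}) := by
  obtain ⟨A, rfl⟩ := hP
  rw [Set.iUnion₂_inter]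
  exact IsPolyhedron.biUnion A fun s _ => isPolyhedron_convexHull_inter_halfspace s l

/-- The solid torus is the union of four boxes, cut from one box by `1 ≤ v 0`, `v 0 ≤ -1`, `1 ≤ v 1`
and `v 1 ≤ -1`. -/
theorem IsPolyhedron.inter_preimage_solidTorus {P : Set E} (hP : IsPolyhedron P)
    (g : E →ᵃ[ℝ] (Fin 3 → ℝ)) : IsPolyhedron (P ∩ g ⁻¹' solidTorus) := by
  have lower (i : Fin 3) (c : ℝ) {R : Set E} (hR : IsPolyhedron R) :
      IsPolyhedron (R ∩ {x | c ≤ g x i}) := by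
    have := hR.inter_halfspace
      (AffineMap.const ℝ E c - (LinearMap.proj i : (Fin 3 → ℝ) →ₗ[ℝ] ℝ).toAffineMap.comp g)
    simpa using this
  have upper (i : Fin 3) (c : ℝ) {R : Set E} (hR : IsPolyhedron R) :
      IsPolyhedron (R ∩ {x | g x i ≤ c}) := by
    have := hR.inter_halfspace
      ((LinearMap.proj i : (Fin 3 → ℝ) →ₗ[ℝ] ℝ).toAffineMap.comp g - AffineMap.const ℝ E c)
    simpa using this
  have hB := upper 2 1 (upper 1 3 (upper 0 3 (lower 2 (-1) (lower 1 (-3) (lower 0 (-3) hP)))))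
  convert ((lower 0 1 hB).union (upper 0 (-1) hB)).union ((lower 1 1 hB).union (upper 1 (-1) hB))
    using 1
  ext x
  simp only [Set.mem_inter_iff, Set.mem_preimage, solidTorus, Set.mem_ofPred_eq, Set.mem_union,
    abs_le, le_abs, le_neg (a := (1 : ℝ))]
  tauto

end Polyhedra

/-! ### Null-homotopic inclusions -/

/-- By compactness `f` is a homeomorphism of `B` onto its image, so the inclusion factors through
the contractible space `B`. -/
theorem nullhomotopic_inclusion_of_convex {E Y : Type*} [AddCommGroup E] [Module ℝ E]
    [TopologicalSpace E] [IsTopologicalAddGroup E] [ContinuousSMul ℝ E] [TopologicalSpace Y]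
    [T2Space Y] {B : Set E} {A P : Set Y} {f : E → Y} (hB : Convex ℝ B) (hne : B.Nonempty)
    (hc : IsCompact B) (hf : ContinuousOn f B) (hinj : Set.InjOn f B) (hA : A ⊆ f '' B)
    (hP : f '' B ⊆ P) (hAP : A ⊆ P) : (ContinuousMap.inclusion hAP).Nullhomotopic := by
  have : CompactSpace B := isCompact_iff_compactSpace.1 hc
  have : ContractibleSpace B := hB.contractibleSpace hne
  have hemb : Topology.IsClosedEmbedding (B.domRestrict f) :=
    hf.domRestrict.isClosedEmbedding (Set.injOn_iff_injective.1 hinj)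
  have hrange : Set.range (B.domRestrict f) = f '' B := Set.range_domRestrict f B
  let h := hemb.isEmbedding.toHomeomorph
  let r : C(A, B) := ⟨fun x => h.symm ⟨x, hrange ▸ hA x.2⟩, by fun_prop⟩
  let j : C(B, P) := ⟨fun v => ⟨f v, hP ⟨v, v.2, rfl⟩⟩, hf.domRestrict.subtype_mk _⟩
  have hfac : ContinuousMap.inclusion hAP = (j.comp (ContinuousMap.id B)).comp r := by
    ext x
    have := h.apply_symm_apply ⟨x, hrange ▸ hA x.2⟩
    exact (congrArg Subtype.val this).symm
  rw [hfac]
  exact ((id_nullhomotopic B).comp_right j).comp_left r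

end PLTop

namespace PLTop

/-! ### Polygonal paths -/

theorem polyPath_cons_zero (v : Fin 3 → ℝ) (l : List (Fin 3 → ℝ)) : polyPath (v :: l) 0 = v := by
  cases l <;> simp [polyPath]

theorem polyPath_cons_cons_of_le {v w : Fin 3 → ℝ} {l : List (Fin 3 → ℝ)} {t : ℝ} (ht : t ≤ 1) :
    polyPath (v :: w :: l) t = AffineMap.lineMap v w t := by
  simp [polyPath, ht]

theorem polyPath_cons_cons_of_ge {v w : Fin 3 → ℝ} {l : List (Fin 3 → ℝ)} {t : ℝ} (ht : 1 ≤ t) :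
    polyPath (v :: w :: l) t = polyPath (w :: l) (t - 1) := by
  rcases ht.eq_or_lt with rfl | ht
  · rw [polyPath_cons_cons_of_le le_rfl, sub_self, polyPath_cons_zero, AffineMap.lineMap_apply_one]
  · simp [polyPath, ht.not_ge]

theorem polyPath_append_of_le (l : List (Fin 3 → ℝ)) (v : Fin 3 → ℝ) (l' : List (Fin 3 → ℝ)) {t : ℝ}
    (h0 : 0 ≤ t) (ht : t ≤ l.length) : polyPath (l ++ v :: l') t = polyPath (l ++ [v]) t := by
  induction l generalizing t with
  | nil =>
    obtain rfl : t = 0 := le_antisymm (by simpa using ht) h0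
    simp only [List.nil_append, polyPath_cons_zero]
  | cons w l ih =>
    rw [List.length_cons, Nat.cast_succ] at ht
    rcases le_total t 1 with h | h
    · cases l <;> simp [polyPath_cons_cons_of_le h]
    · have := ih (t := t - 1) (by linarith) (by linarith)
      cases l <;> simpa [polyPath_cons_cons_of_ge h] using this

theorem polyPath_append_of_ge (l : List (Fin 3 → ℝ)) (v : Fin 3 → ℝ) (l' : List (Fin 3 → ℝ)) {t : ℝ}
    (ht : l.length ≤ t) : polyPath (l ++ v :: l') t = polyPath (v :: l') (t - l.length) := by
  induction l generalizing t with
  | nil => simp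
  | cons w l ih =>
    rw [List.length_cons, Nat.cast_succ] at ht ⊢
    have h : 1 ≤ t := by linarith [(Nat.cast_nonneg l.length : (0 : ℝ) ≤ l.length)]
    have := ih (t := t - 1) (by linarith)
    rw [show t - (l.length + 1 : ℝ) = t - 1 - l.length by ring, ← this]
    cases l <;> simp [polyPath_cons_cons_of_ge h]

theorem bing_lineMap (v w : Fin 3 → ℝ) (t : ℝ) :
    bing (AffineMap.lineMap v w t) = AffineMap.lineMap (bing v) (bing w) t := by
  ext i
  fin_cases i <;> simp [bing, AffineMap.lineMap_apply] <;> ring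

theorem polyPath_map_bing {l : List (Fin 3 → ℝ)} (hl : l ≠ []) (t : ℝ) :
    polyPath (l.map bing) t = bing (polyPath l t) := by
  induction l generalizing t with
  | nil => exact absurd rfl hl
  | cons v l ih =>
    cases l with
    | nil => rfl
    | cons w l =>
      rcases le_total t 1 with h | h
      · simp only [List.map_cons, polyPath_cons_cons_of_le h, bing_lineMap]
      · have := ih (by simp) (t - 1)
        simpa only [List.map_cons, polyPath_cons_cons_of_ge h] using this

/-- The last vertex is left out because the path will be one that ends on the image of `bing` and
otherwise avoids it; the `Ioc` version serves paths that start there. -/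
theorem polyPath_mem_of_Ico {S : Set (Fin 3 → ℝ)} {l : List (Fin 3 → ℝ)}
    (hl : l.IsChain fun v w => ∀ t ∈ Set.Ico (0 : ℝ) 1, AffineMap.lineMap v w t ∈ S) {t : ℝ}
    (h0 : 0 ≤ t) (ht : t < l.length - 1) : polyPath l t ∈ S := by
  induction l generalizing t with
  | nil => simp at ht; linarith
  | cons v l ih =>
    cases l with
    | nil => simp at ht; linarith
    | cons w l =>
      rw [List.isChain_cons_cons] at hl
      rcases lt_or_ge t 1 with h | h
      · rw [polyPath_cons_cons_of_le h.le]
        exact hl.1 t ⟨h0, h⟩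
      · rw [polyPath_cons_cons_of_ge h]
        refine ih hl.2 (by linarith) ?_
        simp only [List.length_cons, Nat.cast_succ] at ht ⊢
        linarith

theorem polyPath_mem_of_Ioc {S : Set (Fin 3 → ℝ)} {l : List (Fin 3 → ℝ)}
    (hl : l.IsChain fun v w => ∀ t ∈ Set.Ioc (0 : ℝ) 1, AffineMap.lineMap v w t ∈ S) {t : ℝ}
    (h0 : 0 < t) (ht : t ≤ l.length - 1) : polyPath l t ∈ S := by
  induction l generalizing t with
  | nil => simp at ht; linarith
  | cons v l ih =>
    cases l with
    | nil => simp at ht; linarith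
    | cons w l =>
      rw [List.isChain_cons_cons] at hl
      rcases le_or_gt t 1 with h | h
      · rw [polyPath_cons_cons_of_le h]
        exact hl.1 t ⟨h0, h⟩
      · rw [polyPath_cons_cons_of_ge h.le]
        refine ih hl.2 (by linarith) ?_
        simp only [List.length_cons, Nat.cast_succ] at ht ⊢
        linarith

theorem polyPath_mem_of_Icc {S : Set (Fin 3 → ℝ)} {l : List (Fin 3 → ℝ)}
    (hl : l.IsChain fun v w => ∀ t ∈ Set.Icc (0 : ℝ) 1, AffineMap.lineMap v w t ∈ S)
    (hlen : 2 ≤ l.length) {t : ℝ} (h0 : 0 ≤ t) (ht : t ≤ l.length - 1) : polyPath l t ∈ S := by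
  have hlen : (2 : ℝ) ≤ l.length := by exact_mod_cast hlen
  rcases h0.eq_or_lt with rfl | h0
  · exact polyPath_mem_of_Ico (hl.imp fun v w h t ht => h t ⟨ht.1, ht.2.le⟩) le_rfl (by linarith)
  · exact polyPath_mem_of_Ioc (hl.imp fun v w h t ht => h t ⟨ht.1.le, ht.2⟩) h0 ht

/-! ### The solid torus and its embedding in itself -/

/-- A convex box in the solid torus that contains the image of `bing`. -/
def bingBox : Set (Fin 3 → ℝ) := Set.Icc ![11/6, -1/2, -1/2] ![13/6, 1/2, 1/2]

theorem mem_bingBox {v : Fin 3 → ℝ} : v ∈ bingBox ↔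
    (11/6 ≤ v 0 ∧ v 0 ≤ 13/6) ∧ (-1/2 ≤ v 1 ∧ v 1 ≤ 1/2) ∧ (-1/2 ≤ v 2 ∧ v 2 ≤ 1/2) := by
  simp only [bingBox, Set.mem_Icc, Pi.le_def, Fin.forall_fin_succ]
  simp
  tauto

theorem bing_mem_bingBox {v : Fin 3 → ℝ} (hv : v ∈ solidTorus) : bing v ∈ bingBox := by
  obtain ⟨h0, h1, h2, -⟩ := hv
  rw [abs_le] at h0 h1 h2
  rw [mem_bingBox]
  simp only [bing, Matrix.cons_val]
  refine ⟨⟨?_, ?_⟩, ⟨?_, ?_⟩, ?_, ?_⟩ <;> linarith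

theorem bingBox_subset_solidTorus : bingBox ⊆ solidTorus := by
  intro v hv
  obtain ⟨⟨h0, h0'⟩, ⟨h1, h1'⟩, h2, h2'⟩ := mem_bingBox.1 hv
  refine ⟨abs_le.2 ⟨?_, ?_⟩, abs_le.2 ⟨?_, ?_⟩, abs_le.2 ⟨?_, ?_⟩, Or.inl (le_abs.2 (Or.inl ?_))⟩ <;>
    linarith

theorem bing_mapsTo : Set.MapsTo bing solidTorus solidTorus :=
  fun _ hv => bingBox_subset_solidTorus (bing_mem_bingBox hv)

/-- The map `bing` as an affine automorphism of `ℝ³`. -/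
noncomputable def bingEquiv : (Fin 3 → ℝ) ≃ᵃ[ℝ] (Fin 3 → ℝ) where
  toFun := bing
  invFun w := ![6 * w 1, 6 * w 2, 6 * (w 0 - 2)]
  left_inv v := by ext i; fin_cases i <;> simp [bing] <;> ring
  right_inv v := by ext i; fin_cases i <;> simp [bing]
  linear :=
    { toFun := fun v => ![v 2 / 6, v 0 / 6, v 1 / 6]
      invFun := fun w => ![6 * w 1, 6 * w 2, 6 * w 0]
      map_add' := fun v w => by ext i; fin_cases i <;> simp <;> ring
      map_smul' := fun c v => by ext i; fin_cases i <;> simp <;> ring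
      left_inv := fun v => by ext i; fin_cases i <;> simp <;> ring
      right_inv := fun v => by ext i; fin_cases i <;> simp }
  map_vadd' v w := by ext i; fin_cases i <;> simp [bing] <;> ring

theorem exists_affineEquiv_eq_iterate_bing (n : ℕ) :
    ∃ g : (Fin 3 → ℝ) ≃ᵃ[ℝ] (Fin 3 → ℝ), ⇑g = bing^[n] := by
  induction n with
  | zero => exact ⟨AffineEquiv.refl ℝ _, rfl⟩
  | succ n ih =>
    obtain ⟨g, hg⟩ := ih
    refine ⟨bingEquiv.trans g, ?_⟩
    rw [AffineEquiv.coe_trans, hg, Function.iterate_succ]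
    rfl

theorem bing_injective : Function.Injective bing := bingEquiv.injective

theorem continuous_bing : Continuous bing := by
  refine continuous_pi fun i => ?_
  fin_cases i <;> simp only [bing] <;> fun_prop

/-- As `bing^[n]` is an affine automorphism, the set is a projection of the part of the graph of `τ`
whose first coordinate is taken into the solid torus by the inverse automorphism. -/
theorem IsPLOn.isPolyhedron_image_iterate_bing {τ : (Fin 3 → ℝ) → S3} (hτ : IsPLOn τ solidTorus)
    (n : ℕ) : IsPolyhedron (Subtype.val '' (τ '' (bing^[n] '' solidTorus))) := by
  obtain ⟨g, hg⟩ := exists_affineEquiv_eq_iterate_bing n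
  have := (hτ.2.inter_preimage_solidTorus (g.symm.toAffineMap.comp
    (LinearMap.fst ℝ (Fin 3 → ℝ) (Fin 4 → ℝ)).toAffineMap)).image
      (LinearMap.snd ℝ (Fin 3 → ℝ) (Fin 4 → ℝ))
  convert this using 1
  ext y
  constructor
  · rintro ⟨_, ⟨_, ⟨v, hv, rfl⟩, rfl⟩, rfl⟩
    refine ⟨(bing^[n] v, τ (bing^[n] v)), ⟨⟨_, bing_mapsTo.iterate n hv, rfl⟩, ?_⟩, rfl⟩
    have : g.symm (bing^[n] v) = v := by rw [← hg, AffineEquiv.symm_apply_apply]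
    simpa [this] using hv
  · rintro ⟨_, ⟨⟨v, hv, rfl⟩, hgv⟩, rfl⟩
    refine ⟨_, ⟨v, ⟨g.symm v, hgv, ?_⟩, rfl⟩, rfl⟩
    rw [← hg, AffineEquiv.apply_symm_apply]

theorem vec_apply_two (a b c : ℝ) : ![a, b, c] 2 = c := rfl

/-- A criterion for the segment between two points to lie in the solid torus. -/
theorem lineMap_mem_solidTorus {v w : Fin 3 → ℝ}
    (hv : |v 0| ≤ 3 ∧ |v 1| ≤ 3 ∧ |v 2| ≤ 1) (hw : |w 0| ≤ 3 ∧ |w 1| ≤ 3 ∧ |w 2| ≤ 1)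
    (h : (1 ≤ v 0 ∧ 1 ≤ w 0) ∨ (v 0 ≤ -1 ∧ w 0 ≤ -1) ∨ (1 ≤ v 1 ∧ 1 ≤ w 1) ∨
      (v 1 ≤ -1 ∧ w 1 ≤ -1)) {t : ℝ} (ht : t ∈ Set.Icc (0 : ℝ) 1) :
    AffineMap.lineMap v w t ∈ solidTorus := by
  have ge (i : Fin 3) {c : ℝ} (hv : c ≤ v i) (hw : c ≤ w i) : c ≤ AffineMap.lineMap v w t i := by
    rw [AffineMap.pi_lineMap_apply]
    exact (convex_Ici c).lineMap_mem hv hw ht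
  have le (i : Fin 3) {c : ℝ} (hv : v i ≤ c) (hw : w i ≤ c) : AffineMap.lineMap v w t i ≤ c := by
    rw [AffineMap.pi_lineMap_apply]
    exact (convex_Iic c).lineMap_mem hv hw ht
  simp only [abs_le] at hv hw
  refine ⟨abs_le.2 ⟨ge 0 hv.1.1 hw.1.1, le 0 hv.1.2 hw.1.2⟩,
    abs_le.2 ⟨ge 1 hv.2.1.1 hw.2.1.1, le 1 hv.2.1.2 hw.2.1.2⟩,
    abs_le.2 ⟨ge 2 hv.2.2.1 hw.2.2.1, le 2 hv.2.2.2 hw.2.2.2⟩, ?_⟩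
  simp only [le_abs, le_neg (a := (1 : ℝ))]
  rcases h with h | h | h | h
  · exact Or.inl (Or.inl (ge 0 h.1 h.2))
  · exact Or.inl (Or.inr (le 0 h.1 h.2))
  · exact Or.inr (Or.inl (ge 1 h.1 h.2))
  · exact Or.inr (Or.inr (le 1 h.1 h.2))

theorem polyPath_mem_solidTorus {l : List (Fin 3 → ℝ)}
    (hl : l.IsChain fun v w => (|v 0| ≤ 3 ∧ |v 1| ≤ 3 ∧ |v 2| ≤ 1) ∧
      (|w 0| ≤ 3 ∧ |w 1| ≤ 3 ∧ |w 2| ≤ 1) ∧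
      ((1 ≤ v 0 ∧ 1 ≤ w 0) ∨ (v 0 ≤ -1 ∧ w 0 ≤ -1) ∨ (1 ≤ v 1 ∧ 1 ≤ w 1) ∨
        (v 1 ≤ -1 ∧ w 1 ≤ -1)))
    (hlen : 2 ≤ l.length) {t : ℝ} (h0 : 0 ≤ t) (ht : t ≤ l.length - 1) :
    polyPath l t ∈ solidTorus :=
  polyPath_mem_of_Icc (hl.imp fun _ _ h _ ht => lineMap_mem_solidTorus h.1 h.2.1 h.2.2 ht) hlen h0 ht

/-- A criterion for the half-open segment between two points to be disjoint from the image of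
`bing`. -/
theorem lineMap_notMem_image_bing {v w : Fin 3 → ℝ}
    (h : (v 0 < 11/6 ∧ w 0 ≤ 11/6) ∨ (13/6 < v 0 ∧ 13/6 ≤ w 0) ∨ (v 1 < -1/2 ∧ w 1 ≤ -1/2) ∨
      (1/2 < v 1 ∧ 1/2 ≤ w 1) ∨ ((|v 1| < 1/6 ∧ |v 2| < 1/6) ∧ |w 1| ≤ 1/6 ∧ |w 2| ≤ 1/6))
    {t : ℝ} (ht : t ∈ Set.Ico (0 : ℝ) 1) : AffineMap.lineMap v w t ∉ bing '' solidTorus := by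
  have gt (i : Fin 3) {c : ℝ} (hv : c < v i) (hw : c ≤ w i) : c < AffineMap.lineMap v w t i := by
    rw [AffineMap.pi_lineMap_apply, AffineMap.lineMap_apply_module, smul_eq_mul, smul_eq_mul]
    nlinarith [mul_pos (sub_pos.2 ht.2) (sub_pos.2 hv), mul_nonneg ht.1 (sub_nonneg.2 hw)]
  have lt (i : Fin 3) {c : ℝ} (hv : v i < c) (hw : w i ≤ c) : AffineMap.lineMap v w t i < c := by
    rw [AffineMap.pi_lineMap_apply, AffineMap.lineMap_apply_module, smul_eq_mul, smul_eq_mul]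
    nlinarith [mul_pos (sub_pos.2 ht.2) (sub_pos.2 hv), mul_nonneg ht.1 (sub_nonneg.2 hw)]
  rintro ⟨x, hx, hxv⟩
  obtain ⟨⟨h0, h0'⟩, ⟨h1, h1'⟩, -⟩ := mem_bingBox.1 (bing_mem_bingBox hx)
  rw [hxv] at h0 h0' h1 h1'
  rcases h with h | h | h | h | h
  · exact (lt 0 h.1 h.2).not_ge h0
  · exact (gt 0 h.1 h.2).not_ge h0'
  · exact (lt 1 h.1 h.2).not_ge h1
  · exact (gt 1 h.1 h.2).not_ge h1'
  -- The last alternative is a segment through the hole: `|v 1| < 1/6` and `|v 2| < 1/6` describe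
  -- the image under `bing` of the hole `|x 0| < 1`, `|x 1| < 1`. The other four keep the segment on
  -- one side of `bingBox`.
  · simp only [abs_lt, abs_le] at h
    have b1 := lt 1 h.1.1.2 h.2.1.2
    have b2 := gt 1 h.1.1.1 h.2.1.1
    have b3 := lt 2 h.1.2.2 h.2.2.2
    have b4 := gt 2 h.1.2.1 h.2.2.1
    rw [← hxv] at b1 b2 b3 b4
    simp only [bing, Matrix.cons_val] at b1 b2 b3 b4
    rcases hx.2.2.2 with h | h
    · exact (abs_lt.2 ⟨by linarith, by linarith⟩ : |x 0| < 1).not_ge h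
    · exact (abs_lt.2 ⟨by linarith, by linarith⟩ : |x 1| < 1).not_ge h

theorem lineMap_notMem_image_bing_of_Ioc {v w : Fin 3 → ℝ}
    (h : (w 0 < 11/6 ∧ v 0 ≤ 11/6) ∨ (13/6 < w 0 ∧ 13/6 ≤ v 0) ∨ (w 1 < -1/2 ∧ v 1 ≤ -1/2) ∨
      (1/2 < w 1 ∧ 1/2 ≤ v 1) ∨ ((|w 1| < 1/6 ∧ |w 2| < 1/6) ∧ |v 1| ≤ 1/6 ∧ |v 2| ≤ 1/6))
    {t : ℝ} (ht : t ∈ Set.Ioc (0 : ℝ) 1) : AffineMap.lineMap v w t ∉ bing '' solidTorus := by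
  rw [← AffineMap.lineMap_apply_one_sub]
  exact lineMap_notMem_image_bing h ⟨by linarith [ht.2], by linarith [ht.1]⟩

/-! ### The Milnor arcs -/

/-- The vertices of `milnorArc (k + 1)` that precede the copy of `milnorArc k`. -/
noncomputable def milnorPrefix : List (Fin 3 → ℝ) :=
  [bandA, ![-2, 1/2, 0], ![-2, 2, 0], ![5/2, 2, 0], ![5/2, 1/12, 0], ![3/2, 1/12, 0],
    ![3/2, 3/2, 0], ![-3/2, 3/2, 0], ![-3/2, -3/2, 0], ![3/2, -3/2, 0], ![3/2, -1/12, 0],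
    ![5/2, -1/12, 0], ![5/2, -2, 0], ![25/12, -2, 0]]

/-- The vertices of `milnorArc (k + 1)` that follow the copy of `milnorArc k`. -/
noncomputable def milnorSuffix : List (Fin 3 → ℝ) := [![23/12, -2, 0], ![-2, -2, 0], ![-2, -1/2, 0], bandB]

theorem milnorArc_succ (k : ℕ) :
    milnorArc (k + 1) = milnorPrefix ++ ((milnorArc k).map bing ++ milnorSuffix) := by
  simp [milnorArc, milnorChain, milnorPrefix, milnorSuffix]

/-- Each Bing doubling adds 14 edges before the smaller copy of the arc and 4 after it; hence the
constant 14 in the parameters below. -/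
theorem milnorEdges_succ (k : ℕ) : milnorEdges (k + 1) = milnorEdges k + 18 := by
  simp only [milnorEdges, milnorArc_succ, List.length_append, List.length_map, milnorPrefix,
    milnorSuffix, List.length_cons, List.length_nil]
  push_cast
  ring

theorem milnorEdges_pos (k : ℕ) : 0 < milnorEdges k := by
  simp [milnorEdges, milnorArc]
  positivity

theorem milnorEdges_add (n j : ℕ) : milnorEdges (n + j) = milnorEdges j + 18 * n := by
  induction n with
  | zero => simp
  | succ n ih =>
    rw [Nat.add_right_comm, milnorEdges_succ, ih]
    push_cast
    ring

theorem polyPath_milnorArc_succ_of_le (k : ℕ) {t : ℝ} (h0 : 0 ≤ t) (ht : t ≤ 14) :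
    polyPath (milnorArc (k + 1)) t = polyPath (milnorPrefix ++ [bing bandA]) t := by
  rw [milnorArc_succ, milnorArc, List.map_cons, List.cons_append]
  exact polyPath_append_of_le _ _ _ h0 (ht.trans_eq (by norm_num [milnorPrefix]))

theorem polyPath_milnorArc_succ_of_mem (k : ℕ) {t : ℝ}
    (ht : t ∈ Set.Icc 14 (14 + milnorEdges k)) :
    polyPath (milnorArc (k + 1)) t = bing (polyPath (milnorArc k) (t - 14)) := by
  have hlen : ((milnorPrefix.length : ℕ) : ℝ) = 14 := by norm_num [milnorPrefix]
  rw [milnorArc_succ, ← polyPath_map_bing (by simp [milnorArc]), milnorArc, List.map_cons,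
    List.cons_append, polyPath_append_of_ge _ _ _ (hlen.trans_le ht.1), hlen, ← List.cons_append,
    ← List.map_cons, ← List.cons_append, List.map_append, List.append_assoc, List.map_singleton,
    List.singleton_append]
  refine polyPath_append_of_le _ _ _ (by linarith [ht.1]) ?_
  have := ht.2
  simp only [milnorEdges, milnorArc, List.length_cons, List.length_append, List.length_map,
    List.length_nil] at this ⊢
  push_cast at this ⊢
  linarith

theorem polyPath_milnorArc_succ_of_ge (k : ℕ) {t : ℝ} (ht : 14 + milnorEdges k ≤ t) :
    polyPath (milnorArc (k + 1)) t =
      polyPath (bing bandB :: milnorSuffix) (t - (14 + milnorEdges k)) := by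
  have harc : milnorArc (k + 1) =
      (milnorPrefix ++ (bandA :: milnorChain k).map bing) ++ bing bandB :: milnorSuffix := by
    rw [milnorArc_succ]
    simp [milnorArc]
  have hlen : (((milnorPrefix ++ (bandA :: milnorChain k).map bing).length : ℕ) : ℝ) =
      14 + milnorEdges k := by
    simp only [milnorEdges, milnorArc, milnorPrefix, List.length_cons, List.length_append,
      List.length_map, List.length_nil]
    push_cast
    ring
  rw [harc, polyPath_append_of_ge _ _ _ (hlen.trans_le ht), hlen]

theorem polyPath_milnorArc_mem (k : ℕ) {t : ℝ} (ht : t ∈ Set.Icc 0 (milnorEdges k)) :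
    polyPath (milnorArc k) t ∈ solidTorus := by
  induction k generalizing t with
  | zero =>
    refine polyPath_mem_solidTorus ?_ ?_ ht.1 ht.2
    · norm_num [milnorArc, milnorChain, bandA, bandB, abs_le, vec_apply_two]
    · simp [milnorArc, milnorChain]
  | succ k ih =>
    rcases le_total t 14 with h | h
    · rw [polyPath_milnorArc_succ_of_le k ht.1 h]
      refine polyPath_mem_solidTorus ?_ ?_ ht.1 ?_
      · norm_num [milnorPrefix, bing, bandA, abs_le, vec_apply_two]
      · simp [milnorPrefix]
      · norm_num [milnorPrefix, h]
    · rcases le_total t (14 + milnorEdges k) with h' | h'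
      · rw [polyPath_milnorArc_succ_of_mem k ⟨h, h'⟩]
        exact bing_mapsTo (ih ⟨by linarith, by linarith⟩)
      · rw [polyPath_milnorArc_succ_of_ge k h']
        have ht' := ht.2
        rw [milnorEdges_succ] at ht'
        refine polyPath_mem_solidTorus ?_ ?_ (by linarith) ?_
        · norm_num [milnorSuffix, bing, bandB, abs_le, vec_apply_two]
        · simp [milnorSuffix]
        · norm_num [milnorSuffix]
          linarith

/-- The pieces before and after the copy touch the image of `bing` only at `bing bandA` and `bing
bandB`, where they join the copy. A finite check of edges shows this. -/
theorem mem_Icc_of_polyPath_milnorArc_succ_mem (k : ℕ) {t : ℝ}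
    (ht : t ∈ Set.Icc 0 (milnorEdges (k + 1)))
    (h : polyPath (milnorArc (k + 1)) t ∈ bing '' solidTorus) :
    t ∈ Set.Icc 14 (14 + milnorEdges k) := by
  constructor
  · by_contra! hlt
    rw [polyPath_milnorArc_succ_of_le k ht.1 hlt.le] at h
    refine polyPath_mem_of_Ico (S := (bing '' solidTorus)ᶜ) (List.IsChain.imp
      (fun v w h t ht => lineMap_notMem_image_bing h ht) ?_) ht.1 ?_ h
    · norm_num [milnorPrefix, bing, bandA, abs_le, abs_lt, vec_apply_two]
    · norm_num [milnorPrefix, hlt]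
  · by_contra! hlt
    rw [polyPath_milnorArc_succ_of_ge k hlt.le] at h
    have ht' := ht.2
    rw [milnorEdges_succ] at ht'
    refine polyPath_mem_of_Ioc (S := (bing '' solidTorus)ᶜ) (List.IsChain.imp
      (fun v w h t ht => lineMap_notMem_image_bing_of_Ioc h ht) ?_) (sub_pos.2 hlt) ?_ h
    · norm_num [milnorSuffix, bing, bandB, abs_le, abs_lt, vec_apply_two]
    · norm_num [milnorSuffix]
      linarith

theorem polyPath_milnorArc_add (n j : ℕ) {t : ℝ}
    (ht : t ∈ Set.Icc (14 * n : ℝ) (14 * n + milnorEdges j)) :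
    polyPath (milnorArc (n + j)) t = bing^[n] (polyPath (milnorArc j) (t - 14 * n)) := by
  induction n generalizing t with
  | zero => simp
  | succ n ih =>
    have h1 := ht.1
    have h2 := ht.2
    push_cast at h1 h2 ⊢
    have hn : (0 : ℝ) ≤ n := n.cast_nonneg
    rw [Nat.add_right_comm, polyPath_milnorArc_succ_of_mem (n + j)
      ⟨by linarith, by rw [milnorEdges_add]; linarith⟩, ih ⟨by linarith, by linarith⟩,
      Function.iterate_succ_apply']
    congr 3
    ring

/-- Peel off one layer at a time: injectivity of `bing` turns membership in the deeper torus into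
the same statement for the smaller arc. -/
theorem mem_Icc_of_polyPath_milnorArc_add_mem (n j : ℕ) {t : ℝ}
    (ht : t ∈ Set.Icc 0 (milnorEdges (n + j)))
    (h : polyPath (milnorArc (n + j)) t ∈ bing^[n] '' solidTorus) :
    t ∈ Set.Icc (14 * n : ℝ) (14 * n + milnorEdges j) := by
  induction n generalizing t with
  | zero => simpa using ht
  | succ n ih =>
    rw [Nat.add_right_comm] at h ht
    obtain ⟨v, hv, hvt⟩ := h
    rw [Function.iterate_succ_apply'] at hvt
    have hmem := mem_Icc_of_polyPath_milnorArc_succ_mem (n + j) ht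
      ⟨_, bing_mapsTo.iterate n hv, hvt⟩
    rw [polyPath_milnorArc_succ_of_mem _ hmem] at hvt
    have := ih (t := t - 14) ⟨by linarith [hmem.1], by linarith [hmem.2]⟩
      ⟨v, hv, bing_injective hvt⟩
    push_cast
    exact ⟨by linarith [this.1], by linarith [this.2]⟩

end PLTop

namespace PLTop

/-! ### Elementary moves are allowed in quasi-isotopies -/

theorem isArc_image_Icc {κ : ℝ → S1} {a b : ℝ} (hab : a < b) (hc : ContinuousOn κ (Set.Icc a b))
    (hi : Set.InjOn κ (Set.Icc a b)) : IsArc (κ '' Set.Icc a b) := by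
  let h := (iccHomeoI a b hab).symm
  refine ⟨fun u => κ (h u), hc.domRestrict.comp h.continuous, ?_, ?_⟩
  · intro u v huv
    exact h.injective (Subtype.ext (hi (h u).2 (h v).2 huv))
  · ext θ
    constructor
    · rintro ⟨t, ht, rfl⟩
      exact ⟨h.symm ⟨t, ht⟩, by simp⟩
    · rintro ⟨u, rfl⟩
      exact ⟨h u, (h u).2, rfl⟩

theorem CrossingChange.hasSingleDoublePoint {m : ℕ} (X : CrossingChange m) :
    HasSingleDoublePoint X.sing X.i (X.a ⟨0, by simp⟩) (X.b ⟨0, by simp⟩) := by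
  have ha (t : Set.Icc (-1 : ℝ) 1) : ![(t : ℝ), 0, 0] ∈ cube :=
    strand_mem_cube (abs_le.2 t.2) (by simp) (by simp)
  have hb (t : Set.Icc (-1 : ℝ) 1) : ![0, (t : ℝ), 0] ∈ cube :=
    strand_mem_cube (by simp) (abs_le.2 t.2) (by simp)
  have hinj := X.e_pl.2
  have haa (s t) (h : X.sing X.i (X.a s) = X.sing X.i (X.a t)) : s = t := by
    rw [X.sing_a, X.sing_a] at h
    exact Subtype.ext (congrFun (hinj (ha s) (ha t) h) 0)
  have hbb (s t) (h : X.sing X.i (X.b s) = X.sing X.i (X.b t)) : s = t := by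
    rw [X.sing_b, X.sing_b] at h
    exact Subtype.ext (congrFun (hinj (hb s) (hb t) h) 1)
  have hab (s t) (h : X.sing X.i (X.a s) = X.sing X.i (X.b t)) :
      s = ⟨0, by simp⟩ ∧ t = ⟨0, by simp⟩ := by
    rw [X.sing_a, X.sing_b] at h
    have h := hinj (ha s) (hb t) h
    exact ⟨Subtype.ext (congrFun h 0), Subtype.ext (congrFun h 1).symm⟩
  have hmem (θ) (h : θ ∈ Set.range X.a ∪ Set.range X.b) : X.sing X.i θ ∈ X.e '' cube := by
    rcases h with ⟨t, rfl⟩ | ⟨t, rfl⟩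
    · exact ⟨_, ha t, (X.sing_a t).symm⟩
    · exact ⟨_, hb t, (X.sing_b t).symm⟩
  refine ⟨X.sing_pl, ?_, ?_, ?_⟩
  · intro h
    -- In `pos` the two strands pass over the centre at the heights `1/2` and `0`, so the parameters
    -- differ.
    have h' := congrArg (X.pos.toFun X.i) h
    rw [X.pos_a, X.pos_b] at h'
    have := congrFun (hinj (strand_mem_cube (by simp) (by simp) (by norm_num [abs_le]))
      (strand_mem_cube (by simp) (by simp) (by simp)) h') 2
    norm_num [vec_apply_two] at this
  · rw [X.sing_a, X.sing_b]
  · intro c θ c' θ' h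
    by_cases h₁ : c = X.i ∧ θ ∈ Set.range X.a ∪ Set.range X.b
    · by_cases h₂ : c' = X.i ∧ θ' ∈ Set.range X.a ∪ Set.range X.b
      · obtain ⟨rfl, h₁⟩ := h₁
        obtain ⟨rfl, h₂⟩ := h₂
        rcases h₁ with ⟨s, rfl⟩ | ⟨s, rfl⟩ <;> rcases h₂ with ⟨t, rfl⟩ | ⟨t, rfl⟩
        · exact Or.inl ⟨rfl, by rw [haa s t h]⟩
        · obtain ⟨rfl, rfl⟩ := hab s t h
          exact Or.inr ⟨rfl, rfl, Or.inl ⟨rfl, rfl⟩⟩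
        · obtain ⟨rfl, rfl⟩ := hab t s h.symm
          exact Or.inr ⟨rfl, rfl, Or.inr ⟨rfl, rfl⟩⟩
        · exact Or.inl ⟨rfl, by rw [hbb s t h]⟩
      · obtain ⟨rfl, h₁⟩ := h₁
        exact absurd (h ▸ hmem θ h₁) (X.outside c' θ' h₂).1
    · by_cases h₂ : c' = X.i ∧ θ' ∈ Set.range X.a ∪ Set.range X.b
      · obtain ⟨rfl, h₂⟩ := h₂
        exact absurd (h ▸ hmem θ' h₂) (X.outside c θ h₁).1
      · rw [← (X.outside c θ h₁).2.1, ← (X.outside c' θ' h₂).2.1] at h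
        have := X.pos.inj (a₁ := (c, θ)) (a₂ := (c', θ')) h
        exact Or.inl ⟨congrArg Prod.fst this, congrArg Prod.snd this⟩

theorem claspChart_zero_mem : claspChart 0 ∈ solidTorus := by
  norm_num [claspChart, solidTorus, vec_apply_two, abs_le, le_abs]

/-- The nested solid tori of the Milnor curve, numbered from the innermost outwards, are the
polyhedra of a `k`-quasi-embedding. -/
theorem IsElementaryMove.isAllowed {m k : ℕ} {L : PLLink m} {X : CrossingChange m}
    (h : IsElementaryMove k L X) : X.IsAllowed k := by
  obtain ⟨τ, β, κ, hτ, hdisj, -, -, hβ, hκc, hκi, -, hout, hleft, hmid, hright, he⟩ := h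
  set p := X.a ⟨0, by simp⟩
  have hL (c θ) : L.toFun c θ ∉ τ '' solidTorus := fun hmem =>
    Set.disjoint_left.1 hdisj hmem ⟨c, θ, rfl⟩
  have hsub (n : ℕ) : bing^[n] '' solidTorus ⊆ solidTorus := (bing_mapsTo.iterate n).image_subset
  have hpt : X.sing X.i p ∈ τ '' (bing^[k] '' solidTorus) := by
    refine ⟨_, ⟨claspChart 0, claspChart_zero_mem, rfl⟩, ?_⟩
    rw [← he 0 ⟨by intro; simp, by intro; simp⟩, X.sing_a]
    congr 1
    ext j
    fin_cases j <;> rfl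
  -- the part of the singular component in the solid torus is the Milnor arc
  have harc (θ) (hθ : X.sing X.i θ ∈ τ '' solidTorus) :
      ∃ t ∈ Set.Icc 0 (milnorEdges k), θ = κ t := by
    by_cases hmem : θ ∈ κ '' Set.Icc (-1) (milnorEdges k + 1)
    · obtain ⟨t, ht, rfl⟩ := hmem
      have he0 := (milnorEdges_pos k).le
      rcases lt_or_ge t 0 with h0 | h0
      -- The long edges of the outer band meet the solid torus only at their ends on its boundary,
      -- which belong to the Milnor arc.
      · have ht' : -t ∈ Set.Icc (0 : ℝ) 1 := ⟨by linarith, by linarith [ht.1]⟩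
        have := hleft (-t) ht'
        rw [neg_neg] at this
        rw [this] at hθ
        have := ((hβ 0 (by simp) (-t) ht').1).1 hθ
        linarith
      · rcases le_or_gt t (milnorEdges k) with h1 | h1
        · exact ⟨t, ⟨h0, h1⟩, rfl⟩
        · have ht' : t - milnorEdges k ∈ Set.Icc (0 : ℝ) 1 := ⟨by linarith, by linarith [ht.2]⟩
          have := hright _ ht'
          rw [add_sub_cancel] at this
          rw [this] at hθ
          have := ((hβ 1 (by simp) _ ht').1).1 hθ
          linarith
    · rw [hout X.i θ fun h => hmem h.2] at hθ
      exact absurd hθ (hL _ _)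
  have hpre (n j : ℕ) (hnj : n + j = k) (θ)
      (hθ : X.sing X.i θ ∈ τ '' (bing^[n] '' solidTorus)) :
      θ ∈ κ '' Set.Icc (14 * n : ℝ) (14 * n + milnorEdges j) := by
    subst hnj
    obtain ⟨t, ht, rfl⟩ := harc θ (Set.image_mono (hsub n) hθ)
    rw [hmid t ht] at hθ
    obtain ⟨v, hv, hvt⟩ := hθ
    have := hτ.2 (hsub n hv) (polyPath_milnorArc_mem _ ht) hvt
    exact ⟨t, mem_Icc_of_polyPath_milnorArc_add_mem n j ht (this ▸ hv), rfl⟩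
  have hJsub (n j : ℕ) (hnj : n + j = k) :
      Set.Icc (14 * n : ℝ) (14 * n + milnorEdges j) ⊆ Set.Icc 0 (milnorEdges k) := by
    subst hnj
    have hn : (0 : ℝ) ≤ n := n.cast_nonneg
    refine Set.Icc_subset_Icc (by linarith) ?_
    rw [milnorEdges_add]
    linarith
  have hJ (n j : ℕ) (hnj : n + j = k) :
      X.sing X.i '' (κ '' Set.Icc (14 * n : ℝ) (14 * n + milnorEdges j)) ⊆
        τ '' (bing^[n] '' solidTorus) := by
    rintro _ ⟨_, ⟨t, ht, rfl⟩, rfl⟩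
    rw [hmid t (hJsub n j hnj ht)]
    subst hnj
    rw [polyPath_milnorArc_add n j ht]
    exact ⟨_, ⟨_, polyPath_milnorArc_mem j ⟨by linarith [ht.1], by linarith [ht.2]⟩, rfl⟩, rfl⟩
  -- Iterates of `bing` count inwards and the `P j` grow outwards, hence the exponent `k - j`. Only
  -- `P 0` is not a torus but the double point inside the innermost one.
  let P : ℕ → Set S3 := fun j =>
    if j = 0 then {X.sing X.i p} else τ '' (bing^[k - j] '' solidTorus)
  have hP (j : ℕ) : P j ⊆ τ '' (bing^[k - j] '' solidTorus) := by
    by_cases hj : j = 0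
    · subst hj
      simpa [P] using hpt
    · simp [P, hj]
  have hPsucc (j : ℕ) : P (j + 1) = τ '' (bing^[k - (j + 1)] '' solidTorus) := by simp [P]
  refine ⟨X.i, p, X.b ⟨0, by simp⟩, X.hasSingleDoublePoint, P, fun j =>
    κ '' Set.Icc (14 * (k - j : ℕ) : ℝ) (14 * (k - j : ℕ) + milnorEdges j), by simp [P], ?_⟩
  intro j hj
  -- Now `P j` and the image of `J j` lie in the torus of depth `n + 1`, while `P (j + 1)` is that
  -- of depth `n`.
  obtain ⟨n, rfl⟩ : ∃ n, k = n + 1 + j := ⟨k - (j + 1), by omega⟩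
  beta_reduce
  rw [show n + 1 + j - j = n + 1 by omega, hPsucc, show n + 1 + j - (j + 1) = n by omega]
  have hPj : P j ⊆ τ '' (bing^[n + 1] '' solidTorus) := by
    simpa [show n + 1 + j - j = n + 1 by omega] using hP j
  refine ⟨hτ.1.isPolyhedron_image_iterate_bing n, ?_, ?_, ?_, ?_, ?_⟩
  · intro c hc θ hθ
    rw [hout c θ fun h => hc h.1] at hθ
    exact hL c θ (Set.image_mono (hsub n) hθ)
  · have hsubset := (hJsub (n + 1) j rfl).trans
      (Set.Icc_subset_Icc (by norm_num) (by linarith) :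
        Set.Icc 0 (milnorEdges (n + 1 + j)) ⊆ Set.Icc (-1) (milnorEdges (n + 1 + j) + 1))
    exact isArc_image_Icc (by linarith [milnorEdges_pos j]) (hκc.mono hsubset) (hκi.mono hsubset)
  · intro _
    rw [milnorEdges_succ]
    refine Set.image_mono (Set.Icc_subset_Icc ?_ ?_) <;> push_cast <;> linarith
  · exact fun θ hθ => hpre (n + 1) j rfl θ (hPj hθ)
  -- The torus of depth `n + 1` lies in the embedded image of the convex `bingBox`, which in turn
  -- lies in the torus of depth `n`.
  · have hA : P j ∪ X.sing X.i '' (κ '' Set.Icc (14 * (n + 1 : ℕ) : ℝ)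
        (14 * (n + 1 : ℕ) + milnorEdges j)) ⊆ (fun v => τ (bing^[n] v)) '' bingBox := by
      refine (Set.union_subset hPj (hJ (n + 1) j rfl)).trans ?_
      rintro _ ⟨_, ⟨v, hv, rfl⟩, rfl⟩
      exact ⟨bing v, bing_mem_bingBox hv, rfl⟩
    have hB : (fun v => τ (bing^[n] v)) '' bingBox ⊆ τ '' (bing^[n] '' solidTorus) := by
      rintro _ ⟨v, hv, rfl⟩
      exact ⟨_, ⟨v, bingBox_subset_solidTorus hv, rfl⟩, rfl⟩
    have hmaps : Set.MapsTo bing^[n] bingBox solidTorus := fun v hv =>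
      bing_mapsTo.iterate n (bingBox_subset_solidTorus hv)
    refine ⟨hA.trans hB, nullhomotopic_inclusion_of_convex (convex_Icc _ _) ?_ isCompact_Icc
      (hτ.1.1.comp (continuous_bing.iterate n).continuousOn hmaps)
      (hτ.2.comp (bing_injective.iterate n).injOn hmaps) hA hB _⟩
    exact ⟨_, bing_mem_bingBox claspChart_zero_mem⟩

end PLTop

theorem theorem3p7 (m k : ℕ) :
    (∀ Q : PLTop.GroupQuotient m, Q.IsMetabelian →
      Q.FunctoriallyInvariant k → Q.FinelyFunctoriallyInvariant k) ∧
    (∀ (L : PLTop.PLLink m) (x : L.compl),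
      (EngelSub.mu (L.meridians x) k).map (QuotientGroup.mk' (derivedSeries (L.grp x) 2)) =
        (EngelSub.delta (L.meridians x) k).map
          (QuotientGroup.mk' (derivedSeries (L.grp x) 2))) := by
  exact ⟨fun _ _ hQ => ⟨hQ.1, fun _ X hX => hQ.2 X hX.isAllowed⟩,
    fun L x => EngelSub.map_mu_eq_map_delta (L.meridians x) k⟩
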